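/- **Setting.** In a continuous-time $GI^X/M^Y/1$ queue, batches arrive with i.i.d. inter-arrival times $\widehat A>0$ having distribution function $\widehat A(x)$, finite mean $1/\widehat\lambda$ and Laplace–Stieltjes transform $A^*(\theta)=\int_0^\infty e^{-\theta x}\,d\widehat A(x)$. Batch sizes $X$ have pmf $g_1,\dots,g_b$ with $g_b\ne 0$, generating function $G$ and mean $\bar g$. Services are completed at rate $\widehat\mu>0$ (exponential service times); a service removes $\min\{Y,n\}$ of the $n$ customers present, where $Y\ge 1$ has pmf $(y_i)_{i\ge1}$, generating function $Y(s)$ and finite mean $\bar y$. Arrivals, batch sizes and services are independent, and $\rho=\widehat\lambda\bar g/(\widehat\mu\bar y)<1$. For a slot length $\Delta>0$ put $a_n=P((n-1)\Delta<\widehat A\le n\Delta)$, $n\ge1$, $A(z)=A_\Delta(z)=\sum_{n\ge1}a_nz^n$, $\mu=\widehat\mu\Delta$, and let $\lambda=\lambda(\Delta)$ be any real function with $\lambda(\Delta)/\Delta\to\widehat\lambda$ as $\Delta\downarrow 0$ (for instance $\lambda=\widehat\lambda\Delta$). The discrete and the continuous characteristic equations are $$A(1-\mu+\mu Y(s))\sum_{i=1}^bg_is^{b-i}-s^b=0,\qquad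 A^*(\widehat\mu(1-Y(s)))\sum_{i=1}^bg_is^{b-i}-s^b=0 .$$ When $r_1,\dots,r_b$ are the distinct roots of the discrete equation in $|s|<1$, let $c_1,\dots,c_b$ solve $$\sum_{j=1}^b c_jr_j^{-k}=0\ \ (1\le k\le b-1),\qquad \sum_{j=1}^b\frac{c_j}{1-r_j}=\lambda,\tag{S}$$ and consider the discrete-time pre-arrival and arbitrary-epoch formulas $$p_n^-=\frac1\lambda\sum_{j=1}^bc_jr_j^n\ (n\ge0),\qquad p_n=\sum_{j=1}^bc_j\frac{(1-\mu+\mu Y(r_j))\bigl(\sum_{i=1}^bg_ir_j^{b-i}-r_j^b\bigr)}{\mu(1-Y(r_j))}\,r_j^{n-b}\ (n\ge1),$$ $$p_0=1-\sum_{j=1}^bc_j\frac{(1-\mu+\mu Y(r_j))\bigl(\sum_{i=1}^bg_ir_j^{1-i}-r_j\bigr)}{\mu(1-r_j)(1-Y(r_j))}.$$ **Theorem.** All limits are for $\Delta\downarrow0$. 1. The mean $E(A)=\sum_n na_n$ satisfies $\Delta\,E(A)\to 1/\widehat\lambda$ (so $\lambda=1/E(A)$ is also admissible above). 2. For every $|s|\le1$,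 $A(1-\mu+\mu Y(s))\to A^*(\widehat\mu(1-Y(s)))$; hence the left side of the discrete characteristic equation converges to that of the continuous one. 3. The continuous characteristic equation, and the discrete one for every $\Delta>0$ with $\widehat\mu\Delta<1$, have exactly $b$ roots in $|s|<1$, counted with multiplicity. 4. Suppose that the $b$ roots $\widehat r_1,\dots,\widehat r_b$ of the continuous equation in $|s|<1$ are distinct. Then for all small $\Delta$ the discrete equation has $b$ distinct roots in $|s|<1$, which can be labelled so that $r_j(\Delta)\to\widehat r_j$ for each $j$. The system (S) with $\widehat r_j,\widehat\lambda$ in place of $r_j,\lambda$ has a unique solution $\widehat c_1,\dots,\widehat c_b$; with $\widehat r_j,\widehat\lambda\Delta$ its only solution is $\widehat c_j\Delta$. For small $\Delta$, (S) has a unique solution $c_j(\Delta)$, and $c_j(\Delta)/\Delta\to\widehat c_j$ when the roots are labelled as above. Moreover $$p_n^-\to\frac1{\widehat\lambda}\sum_{j=1}^b\widehat c_j\widehat r_j^{\,n}\ (n\ge0),\qquad p_n\to\sum_{j=1}^b\widehat c_j\,\frac{G(\widehat r_j^{-1})-1}{\widehat\mu(1-Y(\widehat r_j))}\,\widehat r_j^{\,n}\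 (n\ge1),$$ $$p_0\to1-\sum_{j=1}^b\widehat c_j\,\frac{\sum_{i=1}^bg_i\widehat r_j^{\,1-i}-\widehat r_j}{\widehat\mu(1-\widehat r_j)(1-Y(\widehat r_j))},$$ and the same limits hold if one substitutes $r_j=\widehat r_j$, $c_j=\widehat c_j\Delta$, $\lambda=\widehat\lambda\Delta$, $\mu=\widehat\mu\Delta$ in the discrete formulas. 5. Under the assumption of 4, these limits are the distributions of the continuous-time queue: the first is the unique stationary distribution of the number of customers found by arriving batches, and the other two give the corresponding arbitrary-epoch distribution, i.e. the expected time spent with $n$ customers during one inter-arrival time of the stationary queue, divided by $1/\widehat\lambda$. -/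

import Mathlib

open Filter Topology MeasureTheory

noncomputable section

/-- The data of a continuous-time `GI^X/M^Y/1` queue. Batches of customers arrive at the epochs of
a renewal process, a single server completes services at rate `mu` (exponential service times), and
at each service a batch of at most `Y` customers leaves. -/
structure BatchQueue where
  /-- maximal arriving batch size -/
  b : ℕ
  /-- law of the arriving batch size `X` -/
  g : PMF ℕ
  g_zero : g 0 = 0
  g_top : g b ≠ 0
  g_large : ∀ i, b < i → g i = 0
  /-- law of the service batch size `Y`, which is at least one and has a finite mean -/
  y : PMF ℕ
  y_zero : y 0 = 0
  y_mean : Summable fun i : ℕ => (i : ℝ) * (y i).toReal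
  /-- law of the inter-arrival time, which is positive and has a finite mean -/
  law : Measure ℝ
  law_prob : IsProbabilityMeasure law
  law_pos : law (Set.Iic 0) = 0
  law_mean : Integrable (fun x : ℝ => x) law
  /-- service rate -/
  mu : ℝ
  mu_pos : 0 < mu

namespace BatchQueue

variable (Q : BatchQueue)

/-- Arrival rate of batches: the inverse of the mean inter-arrival time. -/
def lam : ℝ := (∫ x, x ∂Q.law)⁻¹

/-- Mean arriving batch size. -/
def gMean : ℝ := ∑ i ∈ Finset.Icc 1 Q.b, (i : ℝ) * (Q.g i).toReal

/-- Mean service batch size. -/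
def yMean : ℝ := ∑' i : ℕ, (i : ℝ) * (Q.y i).toReal

/-- Traffic intensity. -/
def rho : ℝ := Q.lam * Q.gMean / (Q.mu * Q.yMean)

/-- Probability generating function of the service batch size. -/
def Y (s : ℂ) : ℂ := ∑' i : ℕ, ((Q.y i).toReal : ℂ) * s ^ i

/-- Probability generating function (a polynomial) of the arriving batch size. -/
def G (z : ℂ) : ℂ := ∑ i ∈ Finset.Icc 1 Q.b, ((Q.g i).toReal : ℂ) * z ^ i

/-- The polynomial `∑ i, g i * s ^ (b - i)`. -/
def gRev (s : ℂ) : ℂ := ∑ i ∈ Finset.Icc 1 Q.b, ((Q.g i).toReal : ℂ) * s ^ (Q.b - i)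

/-- Laplace--Stieltjes transform of the inter-arrival time. -/
def lst (θ : ℂ) : ℂ := ∫ x : ℝ, Complex.exp (-θ * x) ∂Q.law

/-! ### Discretisation with slot length `Δ` -/

/-- The probability that the inter-arrival time lies in the `n`-th slot `((n-1)Δ, nΔ]`. -/
def slotProb (Δ : ℝ) (n : ℕ) : ℝ := Q.law.real (Set.Ioc (((n : ℝ) - 1) * Δ) ((n : ℝ) * Δ))

/-- Probability generating function `A(z) = ∑_{n ≥ 1} a_n z ^ n` of the discretised inter-arrival
time. -/
def slotPgf (Δ : ℝ) (z : ℂ) : ℂ := ∑' n : ℕ, (Q.slotProb Δ (n + 1) : ℂ) * z ^ (n + 1)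

/-- Mean of the discretised inter-arrival time, in slots. -/
def slotMean (Δ : ℝ) : ℝ := ∑' n : ℕ, ((n + 1 : ℕ) : ℝ) * Q.slotProb Δ (n + 1)

/-- `A(1 - μ + μ Y(s))` with `μ = mu * Δ`. -/
def discTransform (Δ : ℝ) (s : ℂ) : ℂ :=
  Q.slotPgf Δ (1 - (Q.mu * Δ : ℝ) + (Q.mu * Δ : ℝ) * Q.Y s)

/-- Left-hand side of the characteristic equation of the discretised queue. -/
def discChar (Δ : ℝ) (s : ℂ) : ℂ := Q.discTransform Δ s * Q.gRev s - s ^ Q.b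

/-- Left-hand side of the characteristic equation of the continuous-time queue. -/
def contChar (s : ℂ) : ℂ := Q.lst (Q.mu * (1 - Q.Y s)) * Q.gRev s - s ^ Q.b

/-- The function `f` has exactly `b` zeros in the open unit disc, counted with multiplicity. -/
def HasExactlyZeros (f : ℂ → ℂ) (b : ℕ) : Prop :=
  ∃ Z : Finset ℂ, (∀ s, s ∈ Z ↔ ‖s‖ < 1 ∧ f s = 0) ∧ (∀ s ∈ Z, AnalyticAt ℂ f s) ∧
    ∑ s ∈ Z, analyticOrderNatAt f s = b

/-- `r` lists, without repetition, all zeros of `f` in the open unit disc. -/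
def ListsZeros {b : ℕ} (f : ℂ → ℂ) (r : Fin b → ℂ) : Prop :=
  Function.Injective r ∧ ∀ s, (∃ j, r j = s) ↔ ‖s‖ < 1 ∧ f s = 0

/-- The linear system for the constants `c_1, …, c_b`: the sums `∑ c_j / r_j ^ k` vanish for
`1 ≤ k ≤ b - 1`, and `∑ c_j / (1 - r_j)` is the arrival rate `l`. -/
def SolvesSystem {b : ℕ} (l : ℝ) (r c : Fin b → ℂ) : Prop :=
  (∀ k ∈ Finset.Icc 1 (b - 1), ∑ j, c j / r j ^ k = 0) ∧ ∑ j, c j / (1 - r j) = l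

/-- Pre-arrival epoch formula with arrival rate `l`; it has the same form for the discrete-time and
for the continuous-time queue. -/
def preFormula {b : ℕ} (l : ℝ) (r c : Fin b → ℂ) (n : ℕ) : ℂ := 1 / (l : ℂ) * ∑ j, c j * r j ^ n

/-- Discrete-time arbitrary-epoch formula for `p_n`, `n ≥ 1`, with service probability `m`. -/
def discArb (m : ℝ) (r c : Fin Q.b → ℂ) (n : ℕ) : ℂ :=
  ∑ j, c j * ((1 - m + m * Q.Y (r j)) * (Q.gRev (r j) - r j ^ Q.b) / (m * (1 - Q.Y (r j)))) *
    r j ^ ((n : ℤ) - (Q.b : ℤ))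

/-- Discrete-time arbitrary-epoch formula for `p_0`, with service probability `m`. -/
def discArbZero (m : ℝ) (r c : Fin Q.b → ℂ) : ℂ :=
  1 - ∑ j, c j * ((1 - m + m * Q.Y (r j)) *
    (∑ i ∈ Finset.Icc 1 Q.b, ((Q.g i).toReal : ℂ) * r j ^ (1 - (i : ℤ)) - r j) /
      (m * (1 - r j) * (1 - Q.Y (r j))))

/-- Continuous-time arbitrary-epoch formula for `p_n`, `n ≥ 1`. -/
def contArb (r c : Fin Q.b → ℂ) (n : ℕ) : ℂ :=
  ∑ j, c j * ((Q.G (r j)⁻¹ - 1) / (Q.mu * (1 - Q.Y (r j)))) * r j ^ n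

/-- Continuous-time arbitrary-epoch formula for `p_0`. -/
def contArbZero (r c : Fin Q.b → ℂ) : ℂ :=
  1 - ∑ j, c j *
    ((∑ i ∈ Finset.Icc 1 Q.b, ((Q.g i).toReal : ℂ) * r j ^ (1 - (i : ℤ)) - r j) /
      (Q.mu * (1 - r j) * (1 - Q.Y (r j))))

/-! ### The continuous-time queue -/

/-- One service: from `n` customers, `min {Y, n}` are removed. -/
def serve (n : ℕ) : PMF ℕ := Q.y.map fun j => n - min j n

/-- Law of the number of customers when `k` successive services have been completed and no batch has
arrived, starting from the law `p`. -/
def serveIter (k : ℕ) (p : PMF ℕ) : PMF ℕ := (fun q => q.bind Q.serve)^[k] p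

/-- Law of the number of customers a time `t` after the arrival of a batch that found `n` customers,
if no further batch has arrived: the batch joins, and a `Poisson (mu * t)` number of services is
completed (a service of the empty system changes nothing). -/
def afterArrival (n : ℕ) (t : ℝ) : PMF ℕ :=
  Q.g.bind fun i => (ProbabilityTheory.poissonMeasure (Q.mu * t).toNNReal).toPMF.bind fun k =>
    Q.serveIter k (PMF.pure (n + i))

/-- `π` is stationary for the Markov chain of the numbers of customers found by successive
arriving batches. -/
def IsPreArrivalDist (π : PMF ℕ) : Prop :=
  ∀ m, π m = ∑' n, π n * ∫⁻ x, Q.afterArrival n x m ∂Q.law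

/-- `p` is the arbitrary-epoch distribution that belongs to the stationary pre-arrival
distribution `π`: `p m` is the expected time with `m` customers in the system during one
inter-arrival time of the stationary queue, divided by the mean inter-arrival time. -/
def IsArbitraryEpochDist (π p : PMF ℕ) : Prop :=
  ∀ m, p m = (∑' n, π n * ∫⁻ x, (∫⁻ t in Set.Ioc 0 x, Q.afterArrival n t m) ∂Q.law) /
    ∫⁻ x, ENNReal.ofReal x ∂Q.law

end BatchQueue

end

/-! The rounded inter-arrival time is `⌈x / Δ⌉₊`, so its generating function at 1 - μΔ(1 - w) is the
integral of (1 - μΔ(1 - w))^⌈x/Δ⌉ against the inter-arrival law. For |w| ≤ 1 and small Δ the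
integrand is bounded by one and tends to exp(-μ(1 - w)x). Dominated convergence, jointly in Δ and w
(`tendsto_slotPgf`), gives the pointwise limits on the closed disc and locally uniform convergence
of the characteristic functions on the open disc.

Both root counts come from `hasExactlyZeros_of_transform`. With F(s) - s^b the characteristic
function, replacing every transform by its value at |s| bounds |F(s)| by a real function. That
function minus x^b vanishes at 1, with left derivative equal to the mean number of potential
removals minus the mean number of arrivals per inter-arrival time. This is positive by ρ < 1, hence
|F(s)| < |s|^b near the unit circle, and Jensen's formula counts b zeros. Rounding up only lengthens
inter-arrival times, so the same condition holds for every Δ. A Hurwitz argument moves the roots to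
their limits, and the count excludes any others. The system (S) is a Vandermonde system in disguise,
whose explicit Lagrange solution (`systemSolution`) is continuous in the roots; the limits of the
formulas follow.

For the queue itself, a service multiplies the geometric sequence r^n by Y(r) away from the empty
state. An arriving batch multiplies it by G(1/r), up to boundary terms that the first b - 1
equations of (S) cancel, and averaging over the inter-arrival time produces A*(μ(1 - Y(r))). The
characteristic equation says that the total factor is one, so the pre-arrival formula is stationary
(`exists_isPreArrivalDist`); state 0 is settled by conservation of mass. Reality, positivity and
uniqueness hold because every state reaches 0 in one step, which forces a summable real stationary
sequence to have constant sign. Replacing the inter-arrival law by the law of the elapsed time gives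
the arbitrary-epoch formulas (`exists_isArbitraryEpochDist`). -/

/-! ### Counting zeros in the disc by Jensen's formula -/

/-- Since |w| < 1 keeps 1 - w in the slit plane, the integrand is the real part of the holomorphic
function log(1 - w), and Cauchy's theorem on the annulus makes its circle averages independent of
the radius. -/
theorem circleAverage_log_norm_one_sub_eq {w : ℂ → ℂ} {r R : ℝ} (h0 : 0 < r) (hle : r ≤ R)
    (hd : ∀ z, r ≤ ‖z‖ → ‖z‖ ≤ R → DifferentiableAt ℂ w z)
    (hw : ∀ z, r ≤ ‖z‖ → ‖z‖ ≤ R → ‖w z‖ < 1) :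
    Real.circleAverage (fun z => Real.log ‖1 - w z‖) 0 R =
      Real.circleAverage (fun z => Real.log ‖1 - w z‖) 0 r := by
  set h : ℂ → ℂ := fun z => Complex.log (1 - w z) with hh
  have hdh : ∀ z, r ≤ ‖z‖ → ‖z‖ ≤ R → DifferentiableAt ℂ h z := by
    intro z h1 h2
    refine ((differentiableAt_const _).sub (hd z h1 h2)).clog ?_
    rw [sub_eq_add_neg]
    exact Complex.mem_slitPlane_of_norm_lt_one (by simpa using hw z h1 h2)
  have key : ∀ ρ : ℝ, r ≤ ρ → ρ ≤ R →
      Real.circleAverage (fun z => Real.log ‖1 - w z‖) 0 ρ = (Real.circleAverage h 0 ρ).re := by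
    intro ρ h1 h2
    have hci : IntervalIntegrable (fun θ => h (circleMap 0 ρ θ)) volume 0 (2 * Real.pi) := by
      apply Continuous.intervalIntegrable
      rw [continuous_iff_continuousAt]
      intro θ
      have : ContinuousAt h (circleMap 0 ρ θ) := by
        apply (hdh _ _ _).continuousAt <;> simp [abs_of_pos (h0.trans_le h1), h1, h2]
      exact this.comp (continuous_circleMap 0 ρ).continuousAt
    simp only [Real.circleAverage_def]
    rw [Complex.smul_re]
    congr 1
    have := Complex.reCLM.intervalIntegral_comp_comm hci
    simp only [Complex.reCLM_apply] at this
    rw [← this]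
    simp [hh, Complex.log_re]
  rw [key R hle le_rfl, key r le_rfl hle]
  rw [Real.circleAverage_eq_circleIntegral h0.ne',
    Real.circleAverage_eq_circleIntegral (h0.trans_le hle).ne',
    Complex.circleIntegral_sub_center_inv_smul_eq_of_differentiable_on_annulus_off_countable h0 hle
      Set.countable_empty]
  · intro z hz
    simp at hz
    exact (hdh z hz.2 hz.1).continuousAt.continuousWithinAt
  · intro z hz
    simp at hz
    exact hdh z hz.2.le hz.1.le

namespace BatchQueue

/-- A form of Rouché's theorem that needs nothing on the unit circle. For R in (R₀, 1), Jensen's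
formula makes the average of log|f| over |z| = R equal to N log R + C, with N the number of zeros.
The factorisation f = -z^b (1 - F/z^b) makes it b log R plus a term independent of R. Two radii give
N = b. -/
theorem HasExactlyZeros.of_norm_lt {F : ℂ → ℂ} {b : ℕ} {R₀ : ℝ} (hb : b ≠ 0) (h0 : 0 ≤ R₀)
    (h1 : R₀ < 1) (hF : DifferentiableOn ℂ F (Metric.ball 0 1)) (hF0 : F 0 ≠ 0)
    (hlt : ∀ s : ℂ, R₀ < ‖s‖ → ‖s‖ < 1 → ‖F s‖ < ‖s‖ ^ b) :
    HasExactlyZeros (fun s => F s - s ^ b) b := by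
  set f : ℂ → ℂ := fun s => F s - s ^ b with hf
  have hfan : AnalyticOnNhd ℂ f (Metric.ball 0 1) := by
    apply DifferentiableOn.analyticOnNhd _ Metric.isOpen_ball
    exact hF.sub (by fun_prop)
  have hf0 : f 0 ≠ 0 := by simpa [hf, hb] using hF0
  have hfne : ∀ s : ℂ, R₀ < ‖s‖ → ‖s‖ < 1 → f s ≠ 0 := by
    intro s h1 h2 h3
    have := hlt s h1 h2
    rw [sub_eq_zero.1 h3, norm_pow] at this
    exact lt_irrefl _ this
  have hord : ∀ s : ℂ, ‖s‖ < 1 → analyticOrderAt f s ≠ ⊤ := by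
    intro s hs
    have hpre : IsPreconnected (Metric.ball (0 : ℂ) 1) := (convex_ball _ _).isPreconnected
    refine AnalyticOnNhd.analyticOrderAt_ne_top_of_isPreconnected hfan hpre (x := 0) (by simp)
      (by simpa using hs) ?_
    rw [(hfan 0 (by simp)).analyticOrderAt_eq_zero.2 hf0]
    simp
  have hdiv : ∀ R : ℝ, 0 < R → R < 1 → ∀ u : ℂ, ‖u‖ ≤ R →
      MeromorphicOn.divisor f (Metric.closedBall 0 |R|) u = analyticOrderNatAt f u := by
    intro R hR hR1 u hu
    have han : AnalyticOnNhd ℂ f (Metric.closedBall 0 |R|) :=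
      hfan.mono (Metric.closedBall_subset_ball (by rwa [abs_of_pos hR]))
    rw [MeromorphicOn.AnalyticOnNhd.divisor_apply han (by simpa [abs_of_pos hR] using hu),
      ← Nat.cast_analyticOrderNatAt (hord u (hu.trans_lt hR1))]
    simp
  obtain ⟨R₁, hR01, hR11⟩ := exists_between h1
  have hR1 : 0 < R₁ := h0.trans_lt hR01
  have hfin : {s : ℂ | ‖s‖ < 1 ∧ f s = 0}.Finite := by
    refine ((MeromorphicOn.divisor f (Metric.closedBall 0 |R₁|)).finiteSupport
      (isCompact_closedBall 0 _)).subset ?_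
    rintro s ⟨hs, hfs⟩
    have hsR : ‖s‖ ≤ R₁ := by
      by_contra hcon
      exact hfne s (hR01.trans (not_le.1 hcon)) hs hfs
    rw [Function.mem_support, hdiv R₁ hR1 hR11 s hsR]
    intro h
    have h' : analyticOrderNatAt f s = 0 := by exact_mod_cast h
    have := Nat.cast_analyticOrderNatAt (hord s hs)
    rw [h'] at this
    exact (hfan s (by simpa using hs)).analyticOrderAt_eq_zero.1 this.symm hfs
  set Z := hfin.toFinset with hZ
  have hmem : ∀ s, s ∈ Z ↔ ‖s‖ < 1 ∧ f s = 0 := by simp [hZ]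
  refine ⟨Z, hmem, fun s hs => hfan s (by simpa using ((hmem s).1 hs).1), ?_⟩
  -- The part of Jensen's formula that does not depend on R: all zeros lie in |s| ≤ R₀, so the same
  -- `Z` serves every radius beyond `R₀`.
  set C : ℝ := ∑ u ∈ Z, (analyticOrderNatAt f u : ℝ) * Real.log ‖u‖⁻¹ + Real.log ‖f 0‖
  have hJ : ∀ R : ℝ, R₀ < R → R < 1 → Real.circleAverage (Real.log ‖f ·‖) 0 R =
      (∑ u ∈ Z, analyticOrderNatAt f u : ℕ) * Real.log R + C := by
    intro R hR0 hRlt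
    have hR : 0 < R := h0.trans_lt hR0
    have han : AnalyticOnNhd ℂ f (Metric.closedBall 0 |R|) :=
      hfan.mono (Metric.closedBall_subset_ball (by rwa [abs_of_pos hR]))
    rw [AnalyticOnNhd.circleAverage_log_norm hR.ne' han hf0,
      finsum_eq_sum_of_support_subset (s := Z)]
    · rw [← add_assoc]
      congr 1
      push_cast
      rw [Finset.sum_mul, ← Finset.sum_add_distrib]
      refine Finset.sum_congr rfl fun u hu => ?_
      obtain ⟨hu1, hu0⟩ := (hmem u).1 hu
      have hune : u ≠ 0 := fun h => hf0 (h ▸ hu0)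
      have huR : ‖u‖ ≤ R := by
        by_contra hcon
        exact hfne u (hR0.trans (not_le.1 hcon)) hu1 hu0
      rw [hdiv R hR hRlt u huR, zero_sub, norm_neg, Real.log_mul hR.ne' (by simpa using hune)]
      push_cast
      ring
    · intro u hu
      rw [Function.mem_support] at hu
      have hu' := left_ne_zero_of_mul hu
      have huR : ‖u‖ ≤ R := by
        by_contra hcon
        apply hu'
        rw [Function.locallyFinsuppWithin.apply_eq_zero_of_notMem]
        · simp
        · simpa [abs_of_pos hR] using hcon
      rw [hdiv R hR hRlt u huR] at hu'
      rw [Finset.mem_coe, hmem]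
      refine ⟨huR.trans_lt hRlt, ?_⟩
      apply apply_eq_zero_of_analyticOrderNatAt_ne_zero
      exact_mod_cast hu'
  have hA : ∀ R : ℝ, R₀ < R → R < 1 → Real.circleAverage (Real.log ‖f ·‖) 0 R =
      b * Real.log R + Real.circleAverage (fun z => Real.log ‖1 - F z / z ^ b‖) 0 R := by
    intro R hR0 hRlt
    have hR : 0 < R := h0.trans_lt hR0
    have hcont : ContinuousOn (fun z => Real.log ‖1 - F z / z ^ b‖) (Metric.sphere 0 |R|) := by
      intro z hz
      have hzR : ‖z‖ = R := by simpa [abs_of_pos hR] using hz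
      have hz0 : z ≠ 0 := by rintro rfl; simp at hzR; exact hR.ne hzR
      have hFz : ContinuousAt F z :=
        (hF.differentiableAt (Metric.isOpen_ball.mem_nhds (by simp [hzR, hRlt]))).continuousAt
      apply ContinuousAt.continuousWithinAt
      refine ContinuousAt.log ?_ ?_
      · exact (continuousAt_const.sub (hFz.div (continuousAt_id.pow b) (pow_ne_zero _ hz0))).norm
      · rw [norm_ne_zero_iff]
        intro h
        apply hfne z (by rwa [hzR]) (by rwa [hzR])
        field_simp at h
        rw [hf]
        linear_combination -h
    rw [← Real.circleAverage_const (b * Real.log R) (0 : ℂ) R, ← Real.circleAverage_add]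
    · apply Real.circleAverage_congr_sphere
      intro z hz
      have hzR : ‖z‖ = R := by simpa [abs_of_pos hR] using hz
      have hz0 : z ≠ 0 := by rintro rfl; simp at hzR; exact hR.ne hzR
      have h1 : f z = -(z ^ b * (1 - F z / z ^ b)) := by
        rw [hf]; field_simp; ring
      have h2 : 1 - F z / z ^ b ≠ 0 := by
        intro h
        apply hfne z (by rwa [hzR]) (by rwa [hzR])
        rw [h1, h]; simp
      simp only [h1, norm_neg, norm_mul, norm_pow, hzR, Pi.add_apply]
      rw [Real.log_mul (by positivity) (by simpa using h2), Real.log_pow]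
    · exact circleIntegrable_const _ _ _
    · exact hcont.circleIntegrable'
  obtain ⟨R₂, hR12, hR21⟩ := exists_between hR11
  have hw := circleAverage_log_norm_one_sub_eq (w := fun z => F z / z ^ b) hR1 hR12.le ?_ ?_
  · have e1 := (hJ R₁ hR01 hR11).symm.trans (hA R₁ hR01 hR11)
    have e2 := (hJ R₂ (hR01.trans hR12) hR21).symm.trans (hA R₂ (hR01.trans hR12) hR21)
    rw [hw] at e2
    have hlog : Real.log R₁ < Real.log R₂ := Real.log_lt_log hR1 hR12
    have : ((∑ u ∈ Z, analyticOrderNatAt f u : ℕ) - (b : ℝ)) * (Real.log R₂ - Real.log R₁) = 0 := by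
      linear_combination e2 - e1
    rcases mul_eq_zero.1 this with h | h
    · exact_mod_cast sub_eq_zero.1 h
    · linarith
  · intro z hz1 hz2
    have hz0 : z ≠ 0 := norm_pos_iff.1 (hR1.trans_le hz1)
    exact (hF.differentiableAt (Metric.isOpen_ball.mem_nhds (by simpa using hz2.trans_lt hR21))).div
      (by fun_prop) (pow_ne_zero _ hz0)
  · intro z hz1 hz2
    have hz0 : 0 < ‖z‖ := hR1.trans_le hz1
    rw [norm_div, norm_pow, div_lt_one (by positivity)]
    exact hlt z (hR01.trans_le hz1) (hz2.trans_lt hR21)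

end BatchQueue

/-! ### Convergence of zeros -/

/-- Hurwitz's theorem by the maximum principle: if `F i` had no zero in a small closed disc around
ρ, then 1/|F i(ρ)| would be at most the maximum of 1/|F i| on the bounding circle. That stays
bounded because |f| has a positive minimum there, whereas F i(ρ) tends to 0. -/
theorem eventually_exists_zero_near {ι : Type*} {l : Filter ι} {F : ι → ℂ → ℂ} {f : ℂ → ℂ}
    {U : Set ℂ} (hU : IsOpen U) (hlim : TendstoLocallyUniformlyOn F f l U)
    (hF : ∀ᶠ i in l, DifferentiableOn ℂ (F i) U) (hf : DifferentiableOn ℂ f U) {ρ : ℂ}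
    (hρ : ρ ∈ U) (hfρ : f ρ = 0) (hne : ∀ᶠ z in 𝓝[≠] ρ, f z ≠ 0) {ε : ℝ} (hε : 0 < ε) :
    ∀ᶠ i in l, ∃ s ∈ U, dist s ρ < ε ∧ F i s = 0 := by
  have hev : ∀ᶠ z in 𝓝 ρ, z ∈ U ∧ (z ≠ ρ → f z ≠ 0) :=
    Filter.Eventually.and (hU.mem_nhds hρ) (eventually_nhdsWithin_iff.1 hne)
  obtain ⟨δ, hδ, hball⟩ := Metric.eventually_nhds_iff.1 hev
  set r := min δ ε / 2 with hr
  have hr0 : 0 < r := by positivity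
  have hrδ : r < δ := by have := min_le_left δ ε; rw [hr]; linarith
  have hrε : r < ε := by have := min_le_right δ ε; rw [hr]; linarith
  have hsub : Metric.closedBall ρ r ⊆ U := fun z hz => (hball (lt_of_le_of_lt hz hrδ)).1
  obtain ⟨z₀, hz₀, hmin⟩ := (isCompact_sphere ρ r).exists_isMinOn
    (NormedSpace.sphere_nonempty.2 hr0.le)
    ((hf.continuousOn.mono (Metric.sphere_subset_closedBall.trans hsub)).norm)
  have hz₀' : dist z₀ ρ = r := hz₀
  have hm : 0 < ‖f z₀‖ := norm_pos_iff.2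
    ((hball (hz₀'.trans_lt hrδ)).2 (by rintro rfl; simp at hz₀'; exact hr0.ne hz₀'))
  have hunif := (tendstoLocallyUniformlyOn_iff_forall_isCompact hU).1 hlim _ hsub
    (isCompact_closedBall ρ r)
  have hunif' := Metric.tendstoUniformlyOn_iff.1 hunif (‖f z₀‖ / 2) (by positivity)
  filter_upwards [hunif', hF] with i hi hFi
  by_contra! hcon
  have hne' : ∀ z ∈ Metric.closedBall ρ r, F i z ≠ 0 := fun z hz =>
    hcon z (hsub hz) (lt_of_le_of_lt hz hrε)
  have hd : DiffContOnCl ℂ (fun z => (F i z)⁻¹) (Metric.ball ρ r) := by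
    refine DifferentiableOn.diffContOnCl ?_
    rw [closure_ball _ hr0.ne']
    exact (hFi.mono hsub).inv hne'
  have hbound : ‖(F i ρ)⁻¹‖ ≤ (‖f z₀‖ / 2)⁻¹ := by
    refine Complex.norm_le_of_forall_mem_frontier_norm_le Metric.isBounded_ball hd ?_
      (subset_closure (Metric.mem_ball_self hr0))
    intro z hz
    rw [frontier_ball _ hr0.ne'] at hz
    have h1 := hi z (Metric.sphere_subset_closedBall hz)
    have h2 : ‖f z₀‖ ≤ ‖f z‖ := hmin hz
    rw [dist_eq_norm] at h1
    have h3 := norm_sub_norm_le (f z) (F i z)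
    rw [norm_inv]
    gcongr
    linarith
  have h1 := hi ρ (Metric.mem_closedBall_self hr0.le)
  rw [hfρ, dist_zero_left] at h1
  rw [norm_inv] at hbound
  have h2 : 0 < ‖F i ρ‖ := norm_pos_iff.2 (hne' ρ (Metric.mem_closedBall_self hr0.le))
  exact absurd ((inv_le_inv₀ h2 (by positivity)).1 hbound) (not_le.2 h1)

namespace BatchQueue

/-- Every zero has order at least one and the orders add up to b, so b distinct zeros are all of
them. The point `s₀` only excludes infinite order. -/
theorem ListsZeros.of_injective {b : ℕ} {f : ℂ → ℂ} (hf : HasExactlyZeros f b)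
    (hd : DifferentiableOn ℂ f (Metric.ball 0 1)) {s₀ : ℂ} (hs₀ : ‖s₀‖ < 1) (hfs₀ : f s₀ ≠ 0)
    {r : Fin b → ℂ} (hr : Function.Injective r) (hz : ∀ j, ‖r j‖ < 1 ∧ f (r j) = 0) :
    ListsZeros f r := by
  obtain ⟨Z, hZ, han, hsum⟩ := hf
  refine ⟨hr, fun s => ⟨fun ⟨j, hj⟩ => hj ▸ hz j, fun hs => ?_⟩⟩
  have hfan : AnalyticOnNhd ℂ f (Metric.ball 0 1) := hd.analyticOnNhd Metric.isOpen_ball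
  have hpos : ∀ s ∈ Z, 1 ≤ analyticOrderNatAt f s := by
    intro s hs
    obtain ⟨h1, h2⟩ := (hZ s).1 hs
    have htop : analyticOrderAt f s ≠ ⊤ := by
      refine AnalyticOnNhd.analyticOrderAt_ne_top_of_isPreconnected hfan
        (convex_ball _ _).isPreconnected (x := s₀) (by simpa using hs₀) (by simpa using h1) ?_
      rw [(hfan s₀ (by simpa using hs₀)).analyticOrderAt_eq_zero.2 hfs₀]
      simp
    rw [Nat.one_le_iff_ne_zero]
    intro h
    have := Nat.cast_analyticOrderNatAt htop
    rw [h] at this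
    exact (han s hs).analyticOrderAt_eq_zero.1 this.symm h2
  have hcard : Z.card ≤ b := by
    rw [← hsum, Finset.card_eq_sum_ones]
    exact Finset.sum_le_sum hpos
  have hsub : Finset.univ.image r ⊆ Z := by
    intro s hs
    obtain ⟨j, -, rfl⟩ := Finset.mem_image.1 hs
    exact (hZ _).2 (hz j)
  have heq : Finset.univ.image r = Z := by
    apply Finset.eq_of_subset_of_card_le hsub
    rw [Finset.card_image_of_injective _ hr]
    simpa using hcard
  have := (hZ s).2 hs
  rw [← heq] at this
  simpa using this

theorem exists_listsZeros_tendsto {ι : Type*} {l : Filter ι} {F : ι → ℂ → ℂ} {f : ℂ → ℂ} {b : ℕ}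
    (hlim : TendstoLocallyUniformlyOn F f l (Metric.ball 0 1))
    (hF : ∀ᶠ i in l, DifferentiableOn ℂ (F i) (Metric.ball 0 1))
    (hf : DifferentiableOn ℂ f (Metric.ball 0 1)) (hf0 : f 0 ≠ 0) (hF0 : ∀ᶠ i in l, F i 0 ≠ 0)
    (hFb : ∀ᶠ i in l, HasExactlyZeros (F i) b) {r' : Fin b → ℂ} (hr' : ListsZeros f r') :
    ∃ r : ι → Fin b → ℂ, (∀ᶠ i in l, ListsZeros (F i) (r i)) ∧
      ∀ j, Tendsto (fun i => r i j) l (𝓝 (r' j)) := by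
  have hfan : AnalyticOnNhd ℂ f (Metric.ball 0 1) := hf.analyticOnNhd Metric.isOpen_ball
  have hr'z : ∀ j, ‖r' j‖ < 1 ∧ f (r' j) = 0 := fun j => (hr'.2 _).1 ⟨j, rfl⟩
  have hnear : ∀ ε > 0, ∀ j, ∀ᶠ i in l, ∃ s ∈ Metric.ball (0 : ℂ) 1, dist s (r' j) < ε ∧
      F i s = 0 := by
    intro ε hε j
    refine eventually_exists_zero_near Metric.isOpen_ball hlim hF hf (by simpa using (hr'z j).1)
      (hr'z j).2 ?_ hε
    refine ((hfan _ (by simpa using (hr'z j).1)).eventually_eq_zero_or_eventually_ne_zero).resolve_left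
      fun h => ?_
    exact hf0 (hfan.eqOn_zero_of_preconnected_of_eventuallyEq_zero
      (convex_ball _ _).isPreconnected (by simpa using (hr'z j).1) h (by simp))
  -- Taking the zero nearest to `r' j` makes the choice independent of ε. It exists because the zero
  -- set is finite; without the zero count, or without any zero, the value is arbitrary.
  have hchoice : ∀ i j, ∃ s : ℂ, (HasExactlyZeros (F i) b → ∀ t, ‖t‖ < 1 → F i t = 0 →
      ‖s‖ < 1 ∧ F i s = 0 ∧ dist s (r' j) ≤ dist t (r' j)) := by
    intro i j
    by_cases h : HasExactlyZeros (F i) b ∧ ∃ t, ‖t‖ < 1 ∧ F i t = 0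
    · obtain ⟨⟨Z, hZ, -⟩, t, ht⟩ := h
      obtain ⟨s, hs, hmin⟩ := Z.exists_min_image (fun s => dist s (r' j)) ⟨t, (hZ t).2 ht⟩
      exact ⟨s, fun _ t h1 h2 => ⟨((hZ s).1 hs).1, ((hZ s).1 hs).2, hmin t ((hZ t).2 ⟨h1, h2⟩)⟩⟩
    · exact ⟨0, fun h1 t h2 h3 => absurd ⟨h1, t, h2, h3⟩ h⟩
  choose r hr using hchoice
  have hclose : ∀ ε > 0, ∀ᶠ i in l, ∀ j, ‖r i j‖ < 1 ∧ F i (r i j) = 0 ∧ dist (r i j) (r' j) < ε := by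
    intro ε hε
    filter_upwards [hFb, eventually_all.2 (hnear ε hε)] with i hi h j
    obtain ⟨s, hs, hsε, hs0⟩ := h j
    obtain ⟨h1, h2, h3⟩ := hr i j hi s (by simpa using hs) hs0
    exact ⟨h1, h2, h3.trans_lt hsε⟩
  refine ⟨r, ?_, fun j => Metric.tendsto_nhds.2 fun ε hε => (hclose ε hε).mono fun i h => (h j).2.2⟩
  -- The limits are δ-separated, so zeros within δ/2 of different limits are different. Drawing δ
  -- from a filter, not from a minimum, also covers the absence of distinct indices.
  obtain ⟨δ, hδ, hsep⟩ : ∃ δ > 0, ∀ i j, i ≠ j → δ ≤ dist (r' i) (r' j) := by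
    have hfin : (Set.univ : Set (Fin b × Fin b)).Finite := Set.finite_univ
    have : ∀ᶠ δ in 𝓝[>] (0 : ℝ), ∀ p : Fin b × Fin b, p.1 ≠ p.2 → δ ≤ dist (r' p.1) (r' p.2) := by
      refine eventually_all.2 fun p => ?_
      by_cases hp : p.1 = p.2
      · simp [hp]
      · have : 0 < dist (r' p.1) (r' p.2) := dist_pos.2 fun h => hp (hr'.1 h)
        filter_upwards [Ioo_mem_nhdsGT this] with δ hδ _ using hδ.2.le
    obtain ⟨δ, h1, h2⟩ := (this.and self_mem_nhdsWithin).exists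
    exact ⟨δ, h2, fun i j hij => h1 (i, j) hij⟩
  filter_upwards [hclose (δ / 2) (by positivity), hFb, hF, hF0] with i hi hib hd h0
  refine ListsZeros.of_injective hib hd (s₀ := 0) (by simp) h0 ?_ fun j => ⟨(hi j).1, (hi j).2.1⟩
  intro j k hjk
  by_contra hne
  have h1 := hsep j k hne
  have h2 := (hi j).2.2
  have h3 := (hi k).2.2
  rw [← hjk] at h3
  rw [dist_comm] at h2
  linarith [dist_triangle (r' j) (r i j) (r' k)]

/-! ### The linear system for the constants -/

/-- The Lagrange basis polynomial of the nodes `r` belonging to `r j`, evaluated at one. -/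
noncomputable def lagrangeAtOne {b : ℕ} (r : Fin b → ℂ) (j : Fin b) : ℂ :=
  ∏ i ∈ Finset.univ.erase j, (1 - r i) / (r j - r i)

/-- Interpolation at b nodes reproduces X^m for m < b; evaluate at 1. -/
theorem sum_lagrangeAtOne_mul_pow {b : ℕ} {r : Fin b → ℂ} (hr : Function.Injective r) {m : ℕ}
    (hm : m < b) : ∑ j, lagrangeAtOne r j * r j ^ m = 1 := by
  have h := Lagrange.eq_interpolate (s := Finset.univ) (v := r) (f := (Polynomial.X : Polynomial ℂ) ^ m)
    hr.injOn (by simpa using hm)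
  have h1 := congrArg (Polynomial.eval 1) h
  simp only [Polynomial.eval_pow, Polynomial.eval_X, one_pow, Lagrange.interpolate_apply,
    Polynomial.eval_finsetSum, Polynomial.eval_mul, Polynomial.eval_C] at h1
  rw [h1]
  refine Finset.sum_congr rfl fun j _ => ?_
  rw [mul_comm, lagrangeAtOne, Lagrange.basis, Polynomial.eval_prod]
  congr 1
  refine Finset.prod_congr rfl fun i _ => ?_
  simp [Lagrange.basisDivisor, div_eq_inv_mul]

/-- The solution of the linear system for the constants, for unit arrival rate. -/
noncomputable def systemSolution {b : ℕ} (r : Fin b → ℂ) (j : Fin b) : ℂ :=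
  r j ^ (b - 1) * (1 - r j) * lagrangeAtOne r j

/-- In the unknowns e_j = c_j / (r_j^(b-1) (1 - r_j)), the homogeneous equations say that the
moments ∑ e_j r_j^m, 0 ≤ m ≤ b - 1, are all equal, and the last equation says that the top one is l.
This is a Vandermonde system, solved by l times the Lagrange basis at 1. -/
theorem solvesSystem_iff {b : ℕ} (hb : 0 < b) {r : Fin b → ℂ} (hr : Function.Injective r)
    (h0 : ∀ j, r j ≠ 0) (h1 : ∀ j, r j ≠ 1) (l : ℝ) (c : Fin b → ℂ) :
    SolvesSystem l r c ↔ c = fun j => l * systemSolution r j := by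
  have h1' : ∀ j, 1 - r j ≠ 0 := fun j => sub_ne_zero.2 (h1 j).symm
  constructor
  · rintro ⟨hk, hs⟩
    set e : Fin b → ℂ := fun j => c j / (r j ^ (b - 1) * (1 - r j)) with he
    have hce : ∀ j, c j = e j * (r j ^ (b - 1) * (1 - r j)) := fun j => by
      rw [he]
      have := h0 j
      have := h1' j
      field_simp
    -- The equation with k = b - 1 - m: there c_j / r_j^k = e_j (r_j^m - r_j^(m+1)).
    have hstep : ∀ m, m + 1 < b → ∑ j, e j * r j ^ m = ∑ j, e j * r j ^ (m + 1) := by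
      intro m hm
      have h := hk (b - 1 - m) (Finset.mem_Icc.2 (by omega))
      rw [← sub_eq_zero, ← Finset.sum_sub_distrib, ← h]
      refine Finset.sum_congr rfl fun j _ => ?_
      have hp : r j ^ (b - 1) = r j ^ m * r j ^ (b - 1 - m) := by
        rw [← pow_add]; congr 1; omega
      have := pow_ne_zero (b - 1 - m) (h0 j)
      rw [hce, hp]
      field_simp
      ring
    have htop : ∑ j, e j * r j ^ (b - 1) = l := by
      rw [← hs]
      refine Finset.sum_congr rfl fun j _ => ?_
      have := h1' j
      rw [hce]
      field_simp
    have hall : ∀ k, k < b → ∑ j, e j * r j ^ (b - 1 - k) = l := by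
      intro k
      induction k with
      | zero => intro _; simpa using htop
      | succ k ih =>
        intro hk
        rw [hstep (b - 1 - (k + 1)) (by omega),
          show b - 1 - (k + 1) + 1 = b - 1 - k by omega, ih (by omega)]
    have hv : (fun j => e j - l * lagrangeAtOne r j) = 0 := by
      refine Matrix.eq_zero_of_forall_pow_sum_mul_pow_eq_zero hr fun i => ?_
      have h := hall (b - 1 - i) (by omega)
      rw [show b - 1 - (b - 1 - i) = (i : ℕ) by omega] at h
      simp only [sub_mul, Finset.sum_sub_distrib, h, mul_assoc, ← Finset.mul_sum]
      rw [sum_lagrangeAtOne_mul_pow hr i.2]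
      ring
    funext j
    have := congrFun hv j
    simp only [Pi.zero_apply, sub_eq_zero] at this
    rw [hce, this, systemSolution]
    ring
  · rintro rfl
    constructor
    · intro k hk
      rw [Finset.mem_Icc] at hk
      have e1 := sum_lagrangeAtOne_mul_pow hr (m := b - 1 - k) (by omega)
      have e2 := sum_lagrangeAtOne_mul_pow hr (m := b - 1 - k + 1) (by omega)
      rw [show (0 : ℂ) = l * (1 - 1) by ring]
      nth_rewrite 1 [← e1]
      rw [← e2, ← Finset.sum_sub_distrib, Finset.mul_sum]
      refine Finset.sum_congr rfl fun j _ => ?_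
      have hp : r j ^ (b - 1) = r j ^ (b - 1 - k) * r j ^ k := by
        rw [← pow_add]; congr 1; omega
      have := pow_ne_zero k (h0 j)
      simp only [systemSolution, hp]
      field_simp
      ring
    · have e1 := sum_lagrangeAtOne_mul_pow hr (m := b - 1) (by omega)
      have e2 : (l : ℂ) = ∑ j, l * (lagrangeAtOne r j * r j ^ (b - 1)) := by
        rw [← Finset.mul_sum, e1, mul_one]
      refine Eq.trans ?_ e2.symm
      refine Finset.sum_congr rfl fun j _ => ?_
      have := h1' j
      simp only [systemSolution]
      field_simp

end BatchQueue

/-! ### Power series with nonnegative summable coefficients -/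

section PowerSeries

variable {p : ℕ → ℝ}

theorem norm_ofReal_mul_pow_le (hp : ∀ n, 0 ≤ p n) {s : ℂ} (hs : ‖s‖ ≤ 1) (n : ℕ) :
    ‖(p n : ℂ) * s ^ n‖ ≤ p n := by
  rw [norm_mul, norm_pow, Complex.norm_real, Real.norm_of_nonneg (hp n)]
  exact mul_le_of_le_one_right (hp n) (pow_le_one₀ (norm_nonneg _) hs)

theorem summable_ofReal_mul_pow (hp : ∀ n, 0 ≤ p n) (hs : Summable p) {s : ℂ} (h : ‖s‖ ≤ 1) :
    Summable fun n => (p n : ℂ) * s ^ n :=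
  Summable.of_norm_bounded hs (norm_ofReal_mul_pow_le hp h)

theorem summable_mul_pow (hp : ∀ n, 0 ≤ p n) (hs : Summable p) {x : ℝ} (h0 : 0 ≤ x) (h1 : x ≤ 1) :
    Summable fun n => p n * x ^ n :=
  Summable.of_nonneg_of_le (fun n => mul_nonneg (hp n) (pow_nonneg h0 n))
    (fun n => mul_le_of_le_one_right (hp n) (pow_le_one₀ h0 h1)) hs

theorem differentiableOn_tsum_mul_pow (hp : ∀ n, 0 ≤ p n) (hs : Summable p) :
    DifferentiableOn ℂ (fun s : ℂ => ∑' n, (p n : ℂ) * s ^ n) (Metric.ball 0 1) := by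
  apply Complex.differentiableOn_tsum_of_summable_norm hs
  · intro n
    exact (differentiableOn_id.pow n).const_mul _
  · exact Metric.isOpen_ball
  · intro n s h
    exact norm_ofReal_mul_pow_le hp (by simpa using (Metric.mem_ball.1 h).le) n

theorem norm_tsum_mul_pow_le (hp : ∀ n, 0 ≤ p n) (hs : Summable p) {s : ℂ} (h : ‖s‖ ≤ 1) :
    ‖∑' n, (p n : ℂ) * s ^ n‖ ≤ ∑' n, p n * ‖s‖ ^ n := by
  refine tsum_of_norm_bounded (summable_mul_pow hp hs (norm_nonneg _) h).hasSum fun n => ?_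
  rw [norm_mul, norm_pow, Complex.norm_real, Real.norm_of_nonneg (hp n)]

theorem tsum_mul_pow_mono (hp : ∀ n, 0 ≤ p n) (hs : Summable p) {x y : ℝ} (h0 : 0 ≤ x)
    (hxy : x ≤ y) (h1 : y ≤ 1) : ∑' n, p n * x ^ n ≤ ∑' n, p n * y ^ n := by
  refine Summable.tsum_le_tsum (fun n => ?_) (summable_mul_pow hp hs h0 (hxy.trans h1))
    (summable_mul_pow hp hs (h0.trans hxy) h1)
  have := hp n
  gcongr

theorem tsum_mul_pow_le_self (hp : ∀ n, 0 ≤ p n) (hp0 : p 0 = 0) (hs : Summable p)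
    (hsum : ∑' n, p n = 1) {x : ℝ} (h0 : 0 ≤ x) (h1 : x ≤ 1) : ∑' n, p n * x ^ n ≤ x := by
  have : x = ∑' n, p n * x := by rw [tsum_mul_right, hsum, one_mul]
  conv_rhs => rw [this]
  refine Summable.tsum_le_tsum (fun n => ?_) (summable_mul_pow hp hs h0 h1) (hs.mul_right _)
  rcases n with _ | n
  · simp [hp0]
  · exact mul_le_mul_of_nonneg_left (pow_le_of_le_one h0 h1 n.succ_ne_zero) (hp _)

/-- The difference quotient of x^n at 1 is the geometric sum 1 + x + ... + x^(n-1), which is at most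
n on (0, 1), so the finite mean dominates. Only a left derivative makes sense, as 1 may be the
radius of convergence. -/
theorem hasDerivWithinAt_tsum_mul_pow (hp : ∀ n, 0 ≤ p n)
    (hm : Summable fun n : ℕ => (n : ℝ) * p n) (hs : Summable p) :
    HasDerivWithinAt (fun x : ℝ => ∑' n, p n * x ^ n) (∑' n : ℕ, (n : ℝ) * p n) (Set.Iic 1) 1 := by
  rw [hasDerivWithinAt_iff_tendsto_slope]
  have hset : Set.Iic (1 : ℝ) \ {1} = Set.Iio 1 := by
    ext x; simp [lt_iff_le_and_ne]
  rw [hset]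
  have hmem : Set.Ioo (0 : ℝ) 1 ∈ 𝓝[<] (1 : ℝ) := Ioo_mem_nhdsLT one_pos
  have hlim : Tendsto (fun x : ℝ => ∑' n, p n * ∑ i ∈ Finset.range n, x ^ i) (𝓝[<] 1)
      (𝓝 (∑' n : ℕ, (n : ℝ) * p n)) := by
    refine tendsto_tsum_of_dominated_convergence hm (fun n => ?_) ?_
    · have : Tendsto (fun x : ℝ => p n * ∑ i ∈ Finset.range n, x ^ i) (𝓝 1)
          (𝓝 (p n * ∑ i ∈ Finset.range n, (1 : ℝ) ^ i)) := by
        apply Continuous.tendsto; fun_prop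
      simp only [one_pow, Finset.sum_const, Finset.card_range, nsmul_eq_mul, mul_one] at this
      rw [mul_comm]
      exact this.mono_left nhdsWithin_le_nhds
    · filter_upwards [hmem] with x hx n
      have h0 : 0 ≤ ∑ i ∈ Finset.range n, x ^ i := Finset.sum_nonneg fun i _ => pow_nonneg hx.1.le i
      rw [Real.norm_of_nonneg (mul_nonneg (hp n) h0), mul_comm]
      refine mul_le_mul_of_nonneg_right ?_ (hp n)
      calc ∑ i ∈ Finset.range n, x ^ i ≤ ∑ i ∈ Finset.range n, (1 : ℝ) :=
            Finset.sum_le_sum fun i _ => pow_le_one₀ hx.1.le hx.2.le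
        _ = n := by simp
  refine hlim.congr' ?_
  filter_upwards [hmem] with x hx
  have hx1 : x - 1 ≠ 0 := by linarith [hx.2]
  have h1 : Summable fun n => p n * (1 : ℝ) ^ n := by simpa using hs
  rw [slope_def_field, ← (summable_mul_pow hp hs hx.1.le hx.2.le).tsum_sub h1, ← tsum_div_const]
  refine tsum_congr fun n => ?_
  rw [← mul_sub, one_pow, ← geom_sum_mul x n]
  field_simp

end PowerSeries

/-! ### Batch-size generating functions and the common root count -/

namespace BatchQueue

variable (Q : BatchQueue)

instance : IsProbabilityMeasure Q.law := Q.law_prob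

theorem ae_law_pos : ∀ᵐ x ∂Q.law, 0 < x := by
  rw [ae_iff]
  convert Q.law_pos using 2
  ext x; simp

theorem b_pos : 0 < Q.b := by
  rw [pos_iff_ne_zero]
  intro h
  exact Q.g_top (h ▸ Q.g_zero)

theorem integral_law_pos : 0 < ∫ x, x ∂Q.law := by
  have h0 : 0 ≤ᵐ[Q.law] fun x => x := Q.ae_law_pos.mono fun x hx => hx.le
  rw [integral_pos_iff_support_of_nonneg_ae h0 Q.law_mean, pos_iff_ne_zero]
  intro h
  have : ∀ᵐ x ∂Q.law, x = 0 := by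
    rw [ae_iff]; exact h
  obtain ⟨x, h1, h2⟩ := (this.and Q.ae_law_pos).exists
  exact h2.ne' h1

theorem lam_pos : 0 < Q.lam := inv_pos.2 Q.integral_law_pos

/-- Probabilities of the service batch size as real numbers. -/
noncomputable def yProb (i : ℕ) : ℝ := (Q.y i).toReal

theorem _root_.PMF.hasSum_toReal {α : Type*} (p : PMF α) : HasSum (fun a => (p a).toReal) 1 := by
  have h := ENNReal.hasSum_toReal (f := fun a => p a) (by rw [p.tsum_coe]; simp)
  rwa [← ENNReal.tsum_toReal_eq (fun a => p.apply_ne_top a), p.tsum_coe] at h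

theorem yProb_nonneg (i : ℕ) : 0 ≤ Q.yProb i := ENNReal.toReal_nonneg

theorem yProb_zero : Q.yProb 0 = 0 := by simp [yProb, Q.y_zero]

theorem hasSum_yProb : HasSum Q.yProb 1 := Q.y.hasSum_toReal

theorem Y_eq : Q.Y = fun s : ℂ => ∑' n, (Q.yProb n : ℂ) * s ^ n := rfl

theorem differentiableOn_Y : DifferentiableOn ℂ Q.Y (Metric.ball 0 1) :=
  differentiableOn_tsum_mul_pow Q.yProb_nonneg Q.hasSum_yProb.summable

/-- The generating function of the service batch size on the real line. -/
noncomputable def realY (x : ℝ) : ℝ := ∑' n, Q.yProb n * x ^ n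

theorem norm_Y_le_realY {s : ℂ} (hs : ‖s‖ ≤ 1) : ‖Q.Y s‖ ≤ Q.realY ‖s‖ :=
  norm_tsum_mul_pow_le Q.yProb_nonneg Q.hasSum_yProb.summable hs

theorem realY_le_self {x : ℝ} (h0 : 0 ≤ x) (h1 : x ≤ 1) : Q.realY x ≤ x :=
  tsum_mul_pow_le_self Q.yProb_nonneg Q.yProb_zero Q.hasSum_yProb.summable Q.hasSum_yProb.tsum_eq h0
    h1

theorem realY_nonneg {x : ℝ} (h0 : 0 ≤ x) : 0 ≤ Q.realY x :=
  tsum_nonneg fun n => mul_nonneg (Q.yProb_nonneg n) (pow_nonneg h0 n)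

theorem realY_one : Q.realY 1 = 1 := by simp [realY, Q.hasSum_yProb.tsum_eq]

/-- This uses Y ≥ 1. It keeps Y(s) in the open disc, and hence 1 - Y(s) away from zero in the
denominators. -/
theorem norm_Y_le {s : ℂ} (hs : ‖s‖ ≤ 1) : ‖Q.Y s‖ ≤ ‖s‖ :=
  (Q.norm_Y_le_realY hs).trans (Q.realY_le_self (norm_nonneg _) hs)

theorem Y_zero : Q.Y 0 = 0 := by simpa using Q.norm_Y_le (s := 0) (by simp)

theorem one_sub_Y_ne_zero {s : ℂ} (hs : ‖s‖ < 1) : 1 - Q.Y s ≠ 0 := by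
  intro h
  have := Q.norm_Y_le hs.le
  rw [← sub_eq_zero.1 h, norm_one] at this
  linarith

theorem hasDerivWithinAt_realY : HasDerivWithinAt Q.realY Q.yMean (Set.Iic 1) 1 :=
  hasDerivWithinAt_tsum_mul_pow Q.yProb_nonneg Q.y_mean Q.hasSum_yProb.summable

theorem one_le_yMean : 1 ≤ Q.yMean := by
  rw [← Q.hasSum_yProb.tsum_eq]
  refine Summable.tsum_le_tsum (fun n => ?_) Q.hasSum_yProb.summable Q.y_mean
  rcases n with _ | n
  · simp [Q.yProb_zero]
  · have : (1 : ℝ) ≤ ((n + 1 : ℕ) : ℝ) := by exact_mod_cast n.succ_pos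
    exact le_mul_of_one_le_left (Q.yProb_nonneg _) this

/-- Probabilities of the arriving batch size as real numbers. -/
noncomputable def gProb (i : ℕ) : ℝ := (Q.g i).toReal

theorem gProb_nonneg (i : ℕ) : 0 ≤ Q.gProb i := ENNReal.toReal_nonneg

theorem gProb_b_pos : 0 < Q.gProb Q.b := ENNReal.toReal_pos Q.g_top (Q.g.apply_ne_top _)

theorem sum_gProb : ∑ i ∈ Finset.Icc 1 Q.b, Q.gProb i = 1 := by
  rw [← Q.g.hasSum_toReal.tsum_eq, tsum_eq_sum (s := Finset.Icc 1 Q.b)]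
  · rfl
  · intro i hi
    rw [Finset.mem_Icc, not_and_or] at hi
    rcases hi with hi | hi
    · have : i = 0 := by omega
      simp [this, Q.g_zero]
    · simp [Q.g_large i (by omega)]

/-- The polynomial `∑ i, g i * x ^ (b - i)` on the real line. -/
noncomputable def realGRev (x : ℝ) : ℝ := ∑ i ∈ Finset.Icc 1 Q.b, Q.gProb i * x ^ (Q.b - i)

theorem norm_gRev_le (s : ℂ) : ‖Q.gRev s‖ ≤ Q.realGRev ‖s‖ := by
  refine norm_sum_le_of_le _ fun i _ => ?_
  rw [norm_mul, norm_pow, Complex.norm_real]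
  exact (congrArg (· * _) (Real.norm_of_nonneg (Q.gProb_nonneg i))).le

theorem realGRev_one : Q.realGRev 1 = 1 := by simp [realGRev, sum_gProb]

theorem hasDerivAt_realGRev : HasDerivAt Q.realGRev (Q.b - Q.gMean) 1 := by
  have h : HasDerivAt Q.realGRev (∑ i ∈ Finset.Icc 1 Q.b, Q.gProb i * (((Q.b - i : ℕ) : ℝ) *
      (1 : ℝ) ^ (Q.b - i - 1))) 1 :=
    HasDerivAt.fun_sum fun i _ => (hasDerivAt_pow (Q.b - i) (1 : ℝ)).const_mul _
  convert h using 1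
  have hb : (Q.b : ℝ) = ∑ i ∈ Finset.Icc 1 Q.b, Q.b * Q.gProb i := by
    rw [← Finset.mul_sum, Q.sum_gProb, mul_one]
  rw [gMean, hb, ← Finset.sum_sub_distrib]
  refine Finset.sum_congr rfl fun i hi => ?_
  rw [Nat.cast_sub (Finset.mem_Icc.1 hi).2, gProb, one_pow]
  ring

theorem differentiable_gRev : Differentiable ℂ Q.gRev := by
  unfold gRev
  fun_prop

theorem gRev_zero : Q.gRev 0 = Q.gProb Q.b := by
  rw [gRev, Finset.sum_eq_single Q.b]
  · simp [gProb]
  · intro i hi hne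
    have := (Finset.mem_Icc.1 hi).2
    simp [zero_pow (show Q.b - i ≠ 0 by omega)]
  · intro h
    exact absurd (Finset.mem_Icc.2 ⟨Q.b_pos, le_rfl⟩) h

/-- Serves both equations: `Φ` is the inter-arrival transform as a function of w = Y(s), `φ` its
real majorant, and `D` the mean number of service completions per inter-arrival time. The majorant
φ(Y(x)) ∑ g_i x^(b-i) - x^b vanishes at 1 with left derivative `D * Q.yMean - Q.gMean` > 0, so it is
negative just to the left of 1. -/
theorem hasExactlyZeros_of_transform {Φ : ℂ → ℂ} {φ : ℝ → ℝ} {D : ℝ}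
    (hΦ : DifferentiableOn ℂ Φ (Metric.ball 0 1)) (hΦ0 : Φ 0 ≠ 0)
    (hle : ∀ w : ℂ, ‖w‖ < 1 → ‖Φ w‖ ≤ φ ‖w‖) (hmono : MonotoneOn φ (Set.Icc 0 1)) (h1 : φ 1 = 1)
    (hderiv : HasDerivWithinAt φ D (Set.Iic 1) 1) (hD : Q.gMean < D * Q.yMean) :
    HasExactlyZeros (fun s => Φ (Q.Y s) * Q.gRev s - s ^ Q.b) Q.b := by
  have hmaps : ∀ s : ℂ, ‖s‖ < 1 → ‖Q.Y s‖ < 1 := fun s hs => (Q.norm_Y_le hs.le).trans_lt hs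
  have hcomp : HasDerivWithinAt (fun x => φ (Q.realY x)) (D * Q.yMean) (Set.Icc 0 1) 1 := by
    have h := Q.hasDerivWithinAt_realY.mono (Set.Icc_subset_Iic_self (a := (0 : ℝ)))
    refine HasDerivWithinAt.comp (1 : ℝ) (s' := Set.Iic 1) (by rwa [Q.realY_one]) h ?_
    intro x hx
    exact (Q.realY_le_self hx.1 hx.2).trans hx.2
  have hder : HasDerivWithinAt (fun x => φ (Q.realY x) * Q.realGRev x - x ^ Q.b)
      (D * Q.yMean - Q.gMean) (Set.Icc 0 1) 1 := by
    have h := (hcomp.mul Q.hasDerivAt_realGRev.hasDerivWithinAt).sub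
      (hasDerivAt_pow Q.b (1 : ℝ)).hasDerivWithinAt
    refine h.congr_deriv ?_
    rw [Q.realY_one, h1, Q.realGRev_one]
    ring
  have hpos : 0 < D * Q.yMean - Q.gMean := by linarith
  rw [hasDerivWithinAt_iff_tendsto_slope] at hder
  have hset : Set.Icc (0 : ℝ) 1 \ {1} = Set.Ico 0 1 := by
    ext x; simp [lt_iff_le_and_ne]
  rw [hset] at hder
  have hev := (hder.eventually (lt_mem_nhds hpos)).and self_mem_nhdsWithin
  rw [nhdsWithin_Ico_eq_nhdsLT one_pos] at hev
  obtain ⟨R₀, hR₀, hsub⟩ := (mem_nhdsLT_iff_exists_mem_Ico_Ioo_subset (zero_lt_one (α := ℝ))).1 hev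
  refine HasExactlyZeros.of_norm_lt (F := fun s => Φ (Q.Y s) * Q.gRev s) Q.b_pos.ne' hR₀.1 hR₀.2
    ?_ ?_ ?_
  · refine (hΦ.comp Q.differentiableOn_Y ?_).mul Q.differentiable_gRev.differentiableOn
    intro s hs
    simpa using hmaps s (by simpa using hs)
  · simp only [Q.Y_zero, Q.gRev_zero]
    exact mul_ne_zero hΦ0 (by exact_mod_cast Q.gProb_b_pos.ne')
  · intro s hs0 hs1
    have hs := hsub ⟨hs0, hs1⟩
    obtain ⟨hs2, -⟩ := hs
    rw [slope_def_field, Q.realY_one, h1, Q.realGRev_one, one_pow, one_mul, sub_self, sub_zero] at hs2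
    have hneg : φ (Q.realY ‖s‖) * Q.realGRev ‖s‖ - ‖s‖ ^ Q.b < 0 := by
      by_contra! hcon
      -- The slope from 1 has the negative denominator |s| - 1, so a positive slope forces a
      -- negative value.
      exact absurd hs2 (not_lt.2 (div_nonpos_of_nonneg_of_nonpos hcon (by linarith)))
    have hYle := Q.norm_Y_le_realY hs1.le
    have hb := Q.realY_le_self (norm_nonneg s) hs1.le
    have hφ : ‖Φ (Q.Y s)‖ ≤ φ (Q.realY ‖s‖) :=
      (hle _ (hmaps s hs1)).trans (hmono ⟨norm_nonneg _, (hmaps s hs1).le⟩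
        ⟨Q.realY_nonneg (norm_nonneg _), hb.trans hs1.le⟩ hYle)
    calc ‖Φ (Q.Y s) * Q.gRev s‖ = ‖Φ (Q.Y s)‖ * ‖Q.gRev s‖ := norm_mul _ _
      _ ≤ φ (Q.realY ‖s‖) * Q.realGRev ‖s‖ :=
          mul_le_mul hφ (Q.norm_gRev_le s) (norm_nonneg _) ((norm_nonneg _).trans hφ)
      _ < ‖s‖ ^ Q.b := by linarith

/-! ### The Laplace–Stieltjes transform and the continuous characteristic equation -/

section Lst

theorem norm_exp_neg_mul_ofReal_le {θ : ℂ} (hθ : 0 ≤ θ.re) {x : ℝ} (hx : 0 ≤ x) :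
    ‖Complex.exp (-θ * x)‖ ≤ 1 := by
  rw [Complex.norm_exp]
  simp only [Complex.mul_re, Complex.neg_re, Complex.ofReal_re, Complex.neg_im, Complex.ofReal_im,
    mul_zero, sub_zero]
  rw [Real.exp_le_one_iff]
  nlinarith [mul_nonneg hθ hx]

theorem integrable_exp_neg_mul {θ : ℂ} (hθ : 0 ≤ θ.re) :
    Integrable (fun x : ℝ => Complex.exp (-θ * x)) Q.law := by
  refine Integrable.of_bound (C := 1) (by fun_prop) ?_
  filter_upwards [Q.ae_law_pos] with x hx using norm_exp_neg_mul_ofReal_le hθ hx.le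

theorem differentiableOn_lst : DifferentiableOn ℂ Q.lst {θ | 0 < θ.re} := by
  have h := ProbabilityTheory.differentiableOn_complexMGF (X := fun x : ℝ => x) (μ := Q.law)
  have hlst : Q.lst = fun θ => ProbabilityTheory.complexMGF (fun x : ℝ => x) Q.law (-θ) := rfl
  rw [hlst]
  refine h.comp differentiableOn_id.neg ?_
  intro θ hθ
  have hsub : Set.Iio (0 : ℝ) ⊆ ProbabilityTheory.integrableExpSet (fun x : ℝ => x) Q.law := by
    intro t ht
    have ht' : t < 0 := ht
    refine Integrable.of_bound (C := 1) (by fun_prop) ?_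
    filter_upwards [Q.ae_law_pos] with x hx
    rw [Real.norm_of_nonneg (Real.exp_nonneg _), Real.exp_le_one_iff]
    nlinarith
  have hθ' : 0 < θ.re := hθ
  exact interior_mono hsub (by rw [interior_Iio]; simpa using hθ')

theorem differentiableOn_lst_one_sub :
    DifferentiableOn ℂ (fun w : ℂ => Q.lst (Q.mu * (1 - w))) (Metric.ball 0 1) := by
  refine Q.differentiableOn_lst.comp (by fun_prop) ?_
  intro w hw
  have h1 : w.re < 1 := (Complex.re_le_norm w).trans_lt (by simpa using hw)
  simpa using mul_pos Q.mu_pos (by linarith : 0 < 1 - w.re)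

/-- The function `x ↦ A*(μ (1 - x))` on the real line. -/
noncomputable def realLst (x : ℝ) : ℝ := ∫ t, Real.exp (-(Q.mu * (1 - x) * t)) ∂Q.law

theorem integrable_realLst {x : ℝ} (hx : x ≤ 1) :
    Integrable (fun t : ℝ => Real.exp (-(Q.mu * (1 - x) * t))) Q.law := by
  refine Integrable.of_bound (C := 1) (by fun_prop) ?_
  filter_upwards [Q.ae_law_pos] with t ht
  rw [Real.norm_of_nonneg (Real.exp_nonneg _), Real.exp_le_one_iff, neg_nonpos]
  have := Q.mu_pos
  have : 0 ≤ 1 - x := by linarith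
  positivity

theorem norm_lst_le_realLst {w : ℂ} (hw : ‖w‖ ≤ 1) :
    ‖Q.lst (Q.mu * (1 - w))‖ ≤ Q.realLst ‖w‖ := by
  refine norm_integral_le_of_norm_le (Q.integrable_realLst hw) ?_
  filter_upwards [Q.ae_law_pos] with t ht
  rw [Complex.norm_exp, Real.exp_le_exp]
  simp only [Complex.mul_re, Complex.neg_re, Complex.ofReal_re, Complex.neg_im, Complex.ofReal_im,
    mul_zero, sub_zero, Complex.sub_re, Complex.one_re, Complex.mul_im, zero_mul]
  have h1 := Complex.re_le_norm w
  have h2 := mul_pos Q.mu_pos ht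
  nlinarith

theorem realLst_monotoneOn : MonotoneOn Q.realLst (Set.Icc 0 1) := by
  intro x hx y hy hxy
  refine integral_mono_ae (Q.integrable_realLst hx.2) (Q.integrable_realLst hy.2) ?_
  filter_upwards [Q.ae_law_pos] with t ht
  have := Q.mu_pos
  gcongr

theorem realLst_one : Q.realLst 1 = 1 := by simp [realLst]

theorem hasDerivWithinAt_realLst : HasDerivWithinAt Q.realLst (Q.mu / Q.lam) (Set.Iic 1) 1 := by
  rw [hasDerivWithinAt_iff_tendsto_slope]
  have hlim : Tendsto (fun x : ℝ => ∫ t, slope (fun x => Real.exp (-(Q.mu * (1 - x) * t))) 1 x ∂Q.law)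
      (𝓝[Set.Iic 1 \ {1}] 1) (𝓝 (∫ t, Q.mu * t ∂Q.law)) := by
    refine tendsto_integral_filter_of_dominated_convergence (fun t => Q.mu * t) ?_ ?_
      (Q.law_mean.const_mul _) ?_
    · refine Eventually.of_forall fun x => ?_
      simp only [slope_def_field]
      fun_prop
    · filter_upwards [self_mem_nhdsWithin] with x hx
      have hx1 : x < 1 := lt_of_le_of_ne hx.1 hx.2
      filter_upwards [Q.ae_law_pos] with t ht
      have hu : 0 ≤ Q.mu * (1 - x) * t :=
        mul_nonneg (mul_nonneg Q.mu_pos.le (by linarith)) ht.le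
      -- From 1 - u ≤ exp(-u) with u = μ(1 - x)t, the difference quotient is at most μt, which is
      -- integrable.
      have h1 := Real.add_one_le_exp (-(Q.mu * (1 - x) * t))
      have h2 : Real.exp (-(Q.mu * (1 - x) * t)) ≤ 1 := by simpa using hu
      rw [slope_def_field, Real.norm_eq_abs, abs_div, div_le_iff₀ (by rw [abs_pos]; linarith),
        abs_of_neg (by linarith : x - 1 < 0)]
      simp only [sub_self, mul_zero, zero_mul, neg_zero, Real.exp_zero]
      rw [abs_of_nonpos (by linarith)]
      linarith
    · refine Eventually.of_forall fun t => ?_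
      have hd : HasDerivAt (fun x => Real.exp (-(Q.mu * (1 - x) * t))) (Q.mu * t) 1 := by
        have := (((((hasDerivAt_id (1 : ℝ)).const_sub 1).const_mul Q.mu).mul_const t).neg).exp
        simpa using this
      exact (hasDerivAt_iff_tendsto_slope.1 hd).mono_left
        (nhdsWithin_mono _ fun x hx => hx.2)
  rw [integral_const_mul, show Q.mu * ∫ t, t ∂Q.law = Q.mu / Q.lam by rw [lam, div_inv_eq_mul]] at hlim
  refine hlim.congr' ?_
  filter_upwards [self_mem_nhdsWithin] with x hx
  simp only [slope_def_field, integral_div]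
  rw [integral_sub (Q.integrable_realLst hx.1) (Q.integrable_realLst le_rfl)]
  rfl

theorem gMean_lt (hrho : Q.rho < 1) : Q.gMean < Q.mu / Q.lam * Q.yMean := by
  have h1 := Q.lam_pos
  have h2 := mul_pos Q.mu_pos (lt_of_lt_of_le one_pos Q.one_le_yMean)
  rw [rho, div_lt_one h2] at hrho
  rw [div_mul_eq_mul_div, lt_div_iff₀ h1]
  linarith

theorem lst_mu_ne_zero : Q.lst Q.mu ≠ 0 := by
  have h : Q.lst Q.mu = ((∫ t, Real.exp (-Q.mu * t) ∂Q.law : ℝ) : ℂ) := by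
    rw [← integral_complex_ofReal]
    refine integral_congr_ae (Eventually.of_forall fun t => ?_)
    push_cast
    rfl
  rw [h]
  norm_cast
  refine (integral_exp_pos ?_).ne'
  simpa using Q.integrable_realLst (x := 0) zero_le_one

theorem hasExactlyZeros_contChar (hrho : Q.rho < 1) : HasExactlyZeros Q.contChar Q.b :=
  Q.hasExactlyZeros_of_transform Q.differentiableOn_lst_one_sub (by simpa using Q.lst_mu_ne_zero)
    (fun _ hw => Q.norm_lst_le_realLst hw.le) Q.realLst_monotoneOn Q.realLst_one
    Q.hasDerivWithinAt_realLst (Q.gMean_lt hrho)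

theorem differentiableOn_contChar : DifferentiableOn ℂ Q.contChar (Metric.ball 0 1) := by
  refine ((Q.differentiableOn_lst_one_sub.comp Q.differentiableOn_Y ?_).mul
    Q.differentiable_gRev.differentiableOn).sub (by fun_prop)
  intro s hs
  have hs' : ‖s‖ < 1 := by simpa using hs
  simpa using (Q.norm_Y_le hs'.le).trans_lt hs'

/-- At s = 0 only the term g_b survives, times the Laplace transform at μ, the integral of a
positive function. Hence no root is 0 and negative powers of the roots are harmless. -/
theorem contChar_zero_ne_zero : Q.contChar 0 ≠ 0 := by
  rw [contChar, Q.Y_zero, Q.gRev_zero, zero_pow Q.b_pos.ne', sub_zero, sub_zero, mul_one]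
  exact mul_ne_zero Q.lst_mu_ne_zero (by exact_mod_cast Q.gProb_b_pos.ne')

end Lst

/-! ### The discretised inter-arrival time and the discrete characteristic equation -/

section Slot

variable {Δ : ℝ}

theorem slotProb_zero : Q.slotProb Δ 0 = 0 := by
  have h1 : Q.law (Set.Ioc (((0 : ℕ) - 1 : ℝ) * Δ) ((0 : ℕ) * Δ)) = 0 :=
    measure_mono_null (fun x hx => by simpa using hx.2) Q.law_pos
  rw [slotProb, measureReal_def, h1, ENNReal.toReal_zero]

/-- Identifies the slot number with `⌈x / Δ⌉₊`, so that slot sums become integrals against the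
inter-arrival law. The natural-number ceiling sends all x ≤ 0 to slot 0, a null event. -/
theorem slotProb_eq (hΔ : 0 < Δ) (n : ℕ) :
    Q.slotProb Δ n = Q.law.real ((fun x : ℝ => ⌈x / Δ⌉₊) ⁻¹' {n}) := by
  rcases eq_or_ne n 0 with rfl | hn
  · have h2 : Q.law ((fun x : ℝ => ⌈x / Δ⌉₊) ⁻¹' {0}) = 0 := by
      refine measure_mono_null (fun x hx => ?_) Q.law_pos
      simp only [Set.mem_preimage, Set.mem_singleton_iff, Nat.ceil_eq_zero] at hx
      simpa using (div_le_iff₀ hΔ).1 hx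
    rw [Q.slotProb_zero, measureReal_def, h2, ENNReal.toReal_zero]
  · rw [slotProb]
    congr 1
    ext x
    rw [Set.mem_preimage, Set.mem_singleton_iff, Nat.ceil_eq_iff hn, Set.mem_Ioc,
      lt_div_iff₀ hΔ, div_le_iff₀ hΔ, Nat.cast_sub (Nat.one_le_iff_ne_zero.2 hn), Nat.cast_one]

theorem measurable_ceil_div : Measurable fun x : ℝ => ⌈x / Δ⌉₊ :=
  Nat.measurable_ceil.comp (measurable_id.div_const Δ)

theorem hasSum_slotProb_smul {E : Type*} [NormedAddCommGroup E] [NormedSpace ℝ E] [CompleteSpace E]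
    (hΔ : 0 < Δ) {f : ℕ → E} (hf : Integrable (fun x : ℝ => f ⌈x / Δ⌉₊) Q.law) :
    HasSum (fun n => Q.slotProb Δ n • f n) (∫ x, f ⌈x / Δ⌉₊ ∂Q.law) := by
  have hm : ∀ n : ℕ, MeasurableSet ((fun x : ℝ => ⌈x / Δ⌉₊) ⁻¹' {n}) := fun n =>
    measurable_ceil_div (measurableSet_singleton n)
  have hun : (⋃ n : ℕ, (fun x : ℝ => ⌈x / Δ⌉₊) ⁻¹' {n}) = Set.univ := by
    ext x; simp
  have h := hasSum_integral_iUnion (μ := Q.law) (f := fun x : ℝ => f ⌈x / Δ⌉₊) hm ?_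
    (by rw [hun]; exact hf.integrableOn)
  · rw [hun, setIntegral_univ] at h
    convert h using 2 with n
    rw [setIntegral_congr_fun (g := fun _ => f n) (hm n) (fun x hx => by
      simp only [Set.mem_preimage, Set.mem_singleton_iff] at hx
      simp only [hx]), setIntegral_const, Q.slotProb_eq hΔ]
  · intro i j hij
    exact Disjoint.preimage _ (by simpa using hij)

theorem slotProb_nonneg (n : ℕ) : 0 ≤ Q.slotProb Δ n := measureReal_nonneg

theorem hasSum_slotProb (hΔ : 0 < Δ) : HasSum (Q.slotProb Δ) 1 := by
  simpa using Q.hasSum_slotProb_smul hΔ (f := fun _ => (1 : ℝ)) (integrable_const _)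

theorem ceil_div_mul_bounds (hΔ : 0 < Δ) {x : ℝ} (hx : 0 < x) :
    x ≤ (⌈x / Δ⌉₊ : ℝ) * Δ ∧ (⌈x / Δ⌉₊ : ℝ) * Δ ≤ x + Δ := by
  have h1 := Nat.le_ceil (x / Δ)
  have h2 := (Nat.ceil_lt_add_one (div_pos hx hΔ).le).le
  rw [div_le_iff₀ hΔ] at h1
  refine ⟨h1, ?_⟩
  calc (⌈x / Δ⌉₊ : ℝ) * Δ ≤ (x / Δ + 1) * Δ := by gcongr
    _ = x + Δ := by field_simp

theorem integrable_ceil_div (hΔ : 0 < Δ) : Integrable (fun x : ℝ => (⌈x / Δ⌉₊ : ℝ)) Q.law := by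
  refine Integrable.mono' (g := fun x => (x + Δ) / Δ)
    ((Q.law_mean.add (integrable_const Δ)).div_const Δ) ?_ ?_
  · exact (measurable_from_nat.comp measurable_ceil_div).aestronglyMeasurable
  · filter_upwards [Q.ae_law_pos] with x hx
    rw [Real.norm_of_nonneg (Nat.cast_nonneg _), le_div_iff₀ hΔ]
    exact (ceil_div_mul_bounds hΔ hx).2

theorem hasSum_mul_slotProb (hΔ : 0 < Δ) :
    HasSum (fun n : ℕ => (n : ℝ) * Q.slotProb Δ n) (∫ x, (⌈x / Δ⌉₊ : ℝ) ∂Q.law) := by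
  simpa [mul_comm] using Q.hasSum_slotProb_smul hΔ (f := fun n => (n : ℝ)) (Q.integrable_ceil_div hΔ)

theorem slotMean_eq (hΔ : 0 < Δ) : Q.slotMean Δ = ∫ x, (⌈x / Δ⌉₊ : ℝ) ∂Q.law := by
  have h := Q.hasSum_mul_slotProb hΔ
  rw [← h.tsum_eq, h.summable.tsum_eq_zero_add]
  simp [slotMean]

/-- Rounding up adds between 0 and Δ. The lower bound transfers ρ < 1 to every Δ; both together give
the limit of the mean. -/
theorem slotMean_mul_bounds (hΔ : 0 < Δ) :
    1 / Q.lam ≤ Q.slotMean Δ * Δ ∧ Q.slotMean Δ * Δ ≤ 1 / Q.lam + Δ := by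
  rw [Q.slotMean_eq hΔ, ← integral_mul_const, lam, one_div, inv_inv]
  constructor
  · refine integral_mono_ae Q.law_mean ((Q.integrable_ceil_div hΔ).mul_const Δ) ?_
    filter_upwards [Q.ae_law_pos] with x hx using (ceil_div_mul_bounds hΔ hx).1
  · have h : ∫ x, (⌈x / Δ⌉₊ : ℝ) * Δ ∂Q.law ≤ ∫ x, (x + Δ) ∂Q.law := by
      refine integral_mono_ae ((Q.integrable_ceil_div hΔ).mul_const Δ)
        (Q.law_mean.add (integrable_const Δ)) ?_
      filter_upwards [Q.ae_law_pos] with x hx using (ceil_div_mul_bounds hΔ hx).2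
    rw [integral_add Q.law_mean (integrable_const Δ)] at h
    simpa using h

theorem tendsto_slotMean_mul :
    Tendsto (fun Δ : ℝ => Q.slotMean Δ * Δ) (𝓝[>] 0) (𝓝 (1 / Q.lam)) := by
  have h : Tendsto (fun Δ : ℝ => 1 / Q.lam + Δ) (𝓝[>] 0) (𝓝 (1 / Q.lam)) := by
    have : Tendsto (fun Δ : ℝ => 1 / Q.lam + Δ) (𝓝 0) (𝓝 (1 / Q.lam + 0)) := by
      apply Continuous.tendsto; fun_prop
    rw [add_zero] at this
    exact this.mono_left nhdsWithin_le_nhds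
  refine tendsto_of_tendsto_of_tendsto_of_le_of_le' tendsto_const_nhds h ?_ ?_
  · filter_upwards [self_mem_nhdsWithin] with Δ hΔ using (Q.slotMean_mul_bounds hΔ).1
  · filter_upwards [self_mem_nhdsWithin] with Δ hΔ using (Q.slotMean_mul_bounds hΔ).2

theorem slotPgf_eq_tsum (hΔ : 0 < Δ) {z : ℂ} (hz : ‖z‖ ≤ 1) :
    Q.slotPgf Δ z = ∑' n, (Q.slotProb Δ n : ℂ) * z ^ n := by
  rw [(summable_ofReal_mul_pow (Q.slotProb_nonneg) (Q.hasSum_slotProb hΔ).summable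
    hz).tsum_eq_zero_add]
  simp [slotPgf, Q.slotProb_zero]

theorem slotPgf_eq_integral (hΔ : 0 < Δ) {z : ℂ} (hz : ‖z‖ ≤ 1) :
    Q.slotPgf Δ z = ∫ x, z ^ ⌈x / Δ⌉₊ ∂Q.law := by
  rw [Q.slotPgf_eq_tsum hΔ hz, ← (Q.hasSum_slotProb_smul hΔ (f := fun n => z ^ n) ?_).tsum_eq]
  · simp
  · refine Integrable.of_bound (C := 1)
      (measurable_from_nat.comp measurable_ceil_div).aestronglyMeasurable ?_
    refine Eventually.of_forall fun x => ?_
    rw [norm_pow]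
    exact pow_le_one₀ (norm_nonneg _) hz

theorem norm_one_sub_add_le {m : ℝ} (h0 : 0 ≤ m) (h1 : m ≤ 1) (w : ℂ) :
    ‖1 - (m : ℂ) + m * w‖ ≤ 1 - m + m * ‖w‖ := by
  refine (norm_add_le _ _).trans (le_of_eq ?_)
  rw [norm_mul, ← Complex.ofReal_one, ← Complex.ofReal_sub, Complex.norm_real, Complex.norm_real,
    Real.norm_of_nonneg h0, Real.norm_of_nonneg (by linarith)]

theorem norm_one_sub_add_lt {m : ℝ} (h0 : 0 < m) (h1 : m ≤ 1) {w : ℂ} (hw : ‖w‖ < 1) :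
    ‖1 - (m : ℂ) + m * w‖ < 1 :=
  (norm_one_sub_add_le h0.le h1 w).trans_lt (by nlinarith)

theorem differentiableOn_slotPgf_affine (hΔ : 0 < Δ) {m : ℝ} (h0 : 0 < m) (h1 : m ≤ 1) :
    DifferentiableOn ℂ (fun w : ℂ => Q.slotPgf Δ (1 - (m : ℂ) + m * w)) (Metric.ball 0 1) := by
  have h := (differentiableOn_tsum_mul_pow (Q.slotProb_nonneg)
      (Q.hasSum_slotProb hΔ).summable).comp
    (t := Metric.ball (0 : ℂ) 1) (f := fun w : ℂ => 1 - (m : ℂ) + m * w) (s := Metric.ball 0 1)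
    (by fun_prop) (fun w hw => by simpa using norm_one_sub_add_lt h0 h1 (by simpa using hw))
  refine h.congr fun w hw => ?_
  exact Q.slotPgf_eq_tsum hΔ (norm_one_sub_add_lt h0 h1 (by simpa using hw)).le

theorem slotPgf_affine_zero_ne_zero (hΔ : 0 < Δ) {m : ℝ} (h0 : 0 < m) (h1 : m < 1) :
    Q.slotPgf Δ (1 - (m : ℂ) + m * 0) ≠ 0 := by
  have hsum := Q.hasSum_slotProb hΔ
  have h1m : 0 < 1 - m := by linarith
  have hz : ‖((1 - m : ℝ) : ℂ)‖ ≤ 1 := by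
    rw [Complex.norm_real, Real.norm_of_nonneg h1m.le]; linarith
  have h : Q.slotPgf Δ (1 - (m : ℂ) + m * 0) =
      ((∑' n, Q.slotProb Δ n * (1 - m) ^ n : ℝ) : ℂ) := by
    rw [mul_zero, add_zero, ← Complex.ofReal_one, ← Complex.ofReal_sub,
      Q.slotPgf_eq_tsum hΔ hz, Complex.ofReal_tsum]
    push_cast
    rfl
  simp only [h]
  norm_cast
  obtain ⟨k, hk⟩ : ∃ k, Q.slotProb Δ k ≠ 0 := by
    by_contra! hcon
    have := hsum.tsum_eq
    simp [hcon] at this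
  refine ((summable_mul_pow Q.slotProb_nonneg hsum.summable h1m.le (by linarith)).tsum_pos
    (fun n => mul_nonneg (Q.slotProb_nonneg n) (pow_nonneg h1m.le n)) k ?_).ne'
  exact mul_pos (lt_of_le_of_ne (Q.slotProb_nonneg k) hk.symm) (pow_pos h1m k)

theorem differentiableOn_discChar (hΔ : 0 < Δ) (hm : Q.mu * Δ < 1) :
    DifferentiableOn ℂ (Q.discChar Δ) (Metric.ball 0 1) := by
  refine (((Q.differentiableOn_slotPgf_affine hΔ (mul_pos Q.mu_pos hΔ) hm.le).comp
    Q.differentiableOn_Y ?_).mul Q.differentiable_gRev.differentiableOn).sub (by fun_prop)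
  intro s hs
  have hs' : ‖s‖ < 1 := by simpa using hs
  simpa using (Q.norm_Y_le hs'.le).trans_lt hs'

theorem discChar_zero_ne_zero (hΔ : 0 < Δ) (hm : Q.mu * Δ < 1) : Q.discChar Δ 0 ≠ 0 := by
  rw [discChar, discTransform, Q.Y_zero, Q.gRev_zero, zero_pow Q.b_pos.ne', sub_zero]
  exact mul_ne_zero (Q.slotPgf_affine_zero_ne_zero hΔ (mul_pos Q.mu_pos hΔ) hm)
    (by exact_mod_cast Q.gProb_b_pos.ne')

theorem hasExactlyZeros_discChar (hrho : Q.rho < 1) (hΔ : 0 < Δ) (hm : Q.mu * Δ < 1) :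
    HasExactlyZeros (Q.discChar Δ) Q.b := by
  set m := Q.mu * Δ with hmdef
  have hm0 : 0 < m := mul_pos Q.mu_pos hΔ
  have hsum := Q.hasSum_slotProb hΔ
  have hball : ∀ w : ℂ, ‖w‖ < 1 → ‖1 - (m : ℂ) + m * w‖ < 1 := fun w hw =>
    norm_one_sub_add_lt hm0 hm.le hw
  refine Q.hasExactlyZeros_of_transform (Φ := fun w => Q.slotPgf Δ (1 - (m : ℂ) + m * w))
    (φ := fun x => ∑' n, Q.slotProb Δ n * (1 - m + m * x) ^ n) (D := Q.slotMean Δ * m)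
    (Q.differentiableOn_slotPgf_affine hΔ hm0 hm.le) (Q.slotPgf_affine_zero_ne_zero hΔ hm0 hm)
    ?_ ?_ ?_ ?_ ?_
  · intro w hw
    have h1 := (hball w hw).le
    rw [Q.slotPgf_eq_tsum hΔ h1]
    refine (norm_tsum_mul_pow_le Q.slotProb_nonneg hsum.summable h1).trans ?_
    refine tsum_mul_pow_mono Q.slotProb_nonneg hsum.summable (norm_nonneg _)
      (norm_one_sub_add_le hm0.le hm.le w) (by nlinarith)
  · intro x hx y hy hxy
    exact tsum_mul_pow_mono Q.slotProb_nonneg hsum.summable (by nlinarith [hx.1]) (by nlinarith)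
      (by nlinarith [hy.2])
  · simp [hsum.tsum_eq]
  · have hd := hasDerivWithinAt_tsum_mul_pow Q.slotProb_nonneg
      (Q.hasSum_mul_slotProb hΔ).summable hsum.summable
    rw [(Q.hasSum_mul_slotProb hΔ).tsum_eq, ← Q.slotMean_eq hΔ] at hd
    have ha : HasDerivWithinAt (fun x : ℝ => 1 - m + m * x) m (Set.Iic 1) 1 := by
      simpa using (((hasDerivAt_id (1 : ℝ)).const_mul m).const_add (1 - m)).hasDerivWithinAt
    refine HasDerivWithinAt.comp (1 : ℝ) (s' := Set.Iic 1) (by simpa using hd) ha ?_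
    intro x hx
    have hx' : x ≤ 1 := hx
    simp only [Set.mem_Iic]
    nlinarith
  -- Discretisation does not shorten the mean inter-arrival time, so the continuous stability
  -- condition suffices for any slot length.
  · refine (Q.gMean_lt hrho).trans_le ?_
    have h1 := (Q.slotMean_mul_bounds hΔ).1
    have h2 := Q.one_le_yMean
    have : Q.mu / Q.lam ≤ Q.slotMean Δ * m := by
      rw [hmdef, div_eq_mul_one_div]
      nlinarith [Q.mu_pos]
    nlinarith

end Slot

end BatchQueue

/-! ### Convergence of the transform and of the characteristic function -/

/-- The power is exp(N log(1 + a)), and N(log(1 + a) - a) is bounded by |Na||a| once |a| < 1/2,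
hence tends to 0. -/
theorem tendsto_one_add_pow_exp_of_tendsto_natCast_mul {α : Type*} {l : Filter α} {a : α → ℂ}
    {N : α → ℕ} {t : ℂ} (ha : Tendsto a l (𝓝 0)) (hN : Tendsto (fun i => (N i : ℂ) * a i) l (𝓝 t)) :
    Tendsto (fun i => (1 + a i) ^ N i) l (𝓝 (Complex.exp t)) := by
  have hsmall : ∀ᶠ i in l, ‖a i‖ < 1 / 2 := by
    have h := ha.norm
    rw [norm_zero] at h
    exact h.eventually (gt_mem_nhds (by norm_num))
  have hlog : Tendsto (fun i => (N i : ℂ) * (Complex.log (1 + a i) - a i)) l (𝓝 0) := by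
    have hb : Tendsto (fun i => ‖(N i : ℂ) * a i‖ * ‖a i‖) l (𝓝 0) := by
      simpa using hN.norm.mul ha.norm
    refine squeeze_zero_norm' ?_ hb
    filter_upwards [hsmall] with i hi
    rw [norm_mul, norm_mul, mul_assoc]
    refine mul_le_mul_of_nonneg_left ?_ (norm_nonneg _)
    refine (Complex.norm_log_one_add_sub_self_le (by linarith)).trans ?_
    have h1 : (1 - ‖a i‖)⁻¹ ≤ 2 := by
      rw [inv_le_comm₀ (by linarith) two_pos]
      linarith
    nlinarith [norm_nonneg (a i), mul_self_nonneg ‖a i‖]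
  have hsum := (hN.add hlog).cexp
  rw [add_zero] at hsum
  refine hsum.congr' ?_
  filter_upwards [hsmall] with i hi
  have hne : 1 + a i ≠ 0 := by
    intro h
    have : a i = -1 := by linear_combination h
    rw [this, norm_neg, norm_one] at hi
    norm_num at hi
  rw [← mul_add, add_sub_cancel, Complex.exp_nat_mul, Complex.exp_log hne]

namespace BatchQueue

variable (Q : BatchQueue)

theorem tendsto_ceil_div_mul {x : ℝ} (hx : 0 < x) :
    Tendsto (fun Δ : ℝ => (⌈x / Δ⌉₊ : ℝ) * Δ) (𝓝[>] 0) (𝓝 x) := by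
  have h : Tendsto (fun Δ : ℝ => x + Δ) (𝓝[>] 0) (𝓝 x) := by
    have : Tendsto (fun Δ : ℝ => x + Δ) (𝓝 0) (𝓝 (x + 0)) := by
      apply Continuous.tendsto; fun_prop
    rw [add_zero] at this
    exact this.mono_left nhdsWithin_le_nhds
  refine tendsto_of_tendsto_of_tendsto_of_le_of_le' tendsto_const_nhds h ?_ ?_
  · filter_upwards [self_mem_nhdsWithin] with Δ hΔ using (ceil_div_mul_bounds hΔ hx).1
  · filter_upwards [self_mem_nhdsWithin] with Δ hΔ using (ceil_div_mul_bounds hΔ hx).2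

theorem eventually_mul_lt_one : ∀ᶠ Δ in 𝓝[>] (0 : ℝ), 0 < Δ ∧ Q.mu * Δ < 1 := by
  filter_upwards [Ioo_mem_nhdsGT (inv_pos.2 Q.mu_pos)] with Δ hΔ
  refine ⟨hΔ.1, ?_⟩
  have := mul_lt_mul_of_pos_left hΔ.2 Q.mu_pos
  rwa [mul_inv_cancel₀ Q.mu_pos.ne'] at this

/-- The limit is joint in Δ and w so that it yields both the pointwise and the locally uniform
statement. Restricting w to the closed disc keeps the base of the power of norm at most one, which
makes 1 a dominating function and includes |s| = 1. -/
theorem tendsto_slotPgf {w₀ : ℂ} :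
    Tendsto (fun q : ℝ × ℂ => Q.slotPgf q.1 (1 - (Q.mu * q.1 : ℝ) + (Q.mu * q.1 : ℝ) * q.2))
      (𝓝[>] 0 ×ˢ 𝓝[Metric.closedBall 0 1] w₀) (𝓝 (Q.lst (Q.mu * (1 - w₀)))) := by
  set l : Filter (ℝ × ℂ) := 𝓝[>] 0 ×ˢ 𝓝[Metric.closedBall 0 1] w₀
  have hfst : Tendsto Prod.fst l (𝓝[>] (0 : ℝ)) := tendsto_fst
  have hsnd : Tendsto Prod.snd l (𝓝 w₀) := tendsto_snd.mono_right nhdsWithin_le_nhds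
  have hev : ∀ᶠ q in l, (0 < q.1 ∧ Q.mu * q.1 < 1) ∧ ‖q.2‖ ≤ 1 := by
    refine (hfst.eventually Q.eventually_mul_lt_one).and ?_
    have : ∀ᶠ q in l, q.2 ∈ Metric.closedBall (0 : ℂ) 1 := tendsto_snd.eventually self_mem_nhdsWithin
    filter_upwards [this] with q hq
    simpa using hq
  have hnorm : ∀ᶠ q in l, 0 < q.1 ∧
      ‖1 - ((Q.mu * q.1 : ℝ) : ℂ) + (Q.mu * q.1 : ℝ) * q.2‖ ≤ 1 := by
    filter_upwards [hev] with q hq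
    refine ⟨hq.1.1, (norm_one_sub_add_le (mul_pos Q.mu_pos hq.1.1).le hq.1.2.le q.2).trans ?_⟩
    nlinarith [mul_pos Q.mu_pos hq.1.1, hq.2]
  have hint : Tendsto (fun q : ℝ × ℂ =>
      ∫ x, (1 - ((Q.mu * q.1 : ℝ) : ℂ) + (Q.mu * q.1 : ℝ) * q.2) ^ ⌈x / q.1⌉₊ ∂Q.law) l
      (𝓝 (Q.lst (Q.mu * (1 - w₀)))) := by
    refine tendsto_integral_filter_of_dominated_convergence (fun _ => 1) ?_ ?_
      (integrable_const _) ?_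
    · exact Eventually.of_forall fun q =>
        (measurable_from_nat.comp measurable_ceil_div).aestronglyMeasurable
    · filter_upwards [hnorm] with q hq
      refine Eventually.of_forall fun x => ?_
      rw [norm_pow]
      exact pow_le_one₀ (norm_nonneg _) hq.2
    · filter_upwards [Q.ae_law_pos] with x hx
      have h0 : Tendsto (fun q : ℝ × ℂ => (q.1 : ℂ)) l (𝓝 0) := by
        have := (Complex.continuous_ofReal.tendsto 0).comp (hfst.mono_right nhdsWithin_le_nhds)
        simpa [Function.comp_def] using this
      have hw : Tendsto (fun q : ℝ × ℂ => (Q.mu : ℂ) * (q.2 - 1)) l (𝓝 (Q.mu * (w₀ - 1))) :=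
        (hsnd.sub_const 1).const_mul _
      have ha : Tendsto (fun q : ℝ × ℂ => (q.1 : ℂ) * (Q.mu * (q.2 - 1))) l (𝓝 0) := by
        simpa using h0.mul hw
      have hN : Tendsto (fun q : ℝ × ℂ => (⌈x / q.1⌉₊ : ℂ) * (q.1 * (Q.mu * (q.2 - 1)))) l
          (𝓝 (x * (Q.mu * (w₀ - 1)))) := by
        have h1 := (Complex.continuous_ofReal.tendsto x).comp ((tendsto_ceil_div_mul hx).comp hfst)
        refine (h1.mul hw).congr fun q => ?_
        simp only [Function.comp]
        push_cast
        ring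
      have h := tendsto_one_add_pow_exp_of_tendsto_natCast_mul ha hN
      convert h using 2
      · push_cast
        ring
      · ring_nf
  refine hint.congr' ?_
  filter_upwards [hnorm] with q hq
  exact (Q.slotPgf_eq_integral hq.1 hq.2).symm

theorem tendsto_discTransform {s : ℂ} (hs : ‖s‖ ≤ 1) :
    Tendsto (fun Δ : ℝ => Q.discTransform Δ s) (𝓝[>] 0) (𝓝 (Q.lst (Q.mu * (1 - Q.Y s)))) := by
  have h : Tendsto (fun Δ : ℝ => (Δ, Q.Y s)) (𝓝[>] 0)
      (𝓝[>] 0 ×ˢ 𝓝[Metric.closedBall 0 1] (Q.Y s)) := by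
    refine tendsto_id.prodMk (tendsto_nhdsWithin_iff.2 ⟨tendsto_const_nhds, ?_⟩)
    exact Eventually.of_forall fun _ => by simpa using (Q.norm_Y_le hs).trans hs
  have h' := (Q.tendsto_slotPgf (w₀ := Q.Y s)).comp h
  simpa only [discTransform, Function.comp_def] using h'

theorem tendsto_discChar {s : ℂ} (hs : ‖s‖ ≤ 1) :
    Tendsto (fun Δ : ℝ => Q.discChar Δ s) (𝓝[>] 0) (𝓝 (Q.contChar s)) :=
  ((Q.tendsto_discTransform hs).mul_const _).sub_const _

theorem tendstoLocallyUniformlyOn_discChar :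
    TendstoLocallyUniformlyOn Q.discChar Q.contChar (𝓝[>] 0) (Metric.ball 0 1) := by
  -- On an open set, locally uniform convergence can be checked along the product filter at each
  -- point; the limit is continuous, so joint convergence of both functions to the same value is
  -- enough.
  rw [Metric.isOpen_ball.tendstoLocallyUniformlyOn_iff_forall_tendsto]
  intro s hs
  have hY : ContinuousAt Q.Y s :=
    (Q.differentiableOn_Y.differentiableAt (Metric.isOpen_ball.mem_nhds hs)).continuousAt
  have hsnd : Tendsto Prod.snd (𝓝[>] (0 : ℝ) ×ˢ 𝓝 s) (𝓝 s) := tendsto_snd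
  have hp : Tendsto (fun q : ℝ × ℂ => (q.1, Q.Y q.2)) (𝓝[>] (0 : ℝ) ×ˢ 𝓝 s)
      (𝓝[>] 0 ×ˢ 𝓝[Metric.closedBall 0 1] (Q.Y s)) := by
    refine tendsto_fst.prodMk (tendsto_nhdsWithin_iff.2 ⟨hY.tendsto.comp hsnd, ?_⟩)
    filter_upwards [hsnd.eventually (Metric.isOpen_ball.mem_nhds hs)] with q hq
    have hq' : ‖q.2‖ < 1 := by simpa using hq
    simpa using (Q.norm_Y_le hq'.le).trans hq'.le
  have h1 : Tendsto (fun q : ℝ × ℂ => Q.discChar q.1 q.2) (𝓝[>] (0 : ℝ) ×ˢ 𝓝 s)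
      (𝓝 (Q.contChar s)) := by
    have h := (((Q.tendsto_slotPgf (w₀ := Q.Y s)).comp hp).mul
      ((Q.differentiable_gRev.continuous.tendsto s).comp hsnd)).sub (hsnd.pow Q.b)
    simpa only [discChar, discTransform, contChar, Function.comp_def] using h
  have h2 : Tendsto (fun q : ℝ × ℂ => Q.contChar q.2) (𝓝[>] (0 : ℝ) ×ˢ 𝓝 s)
      (𝓝 (Q.contChar s)) :=
    (Q.differentiableOn_contChar.differentiableAt (Metric.isOpen_ball.mem_nhds hs)).continuousAt.tendsto.comp hsnd
  exact (h2.prodMk_nhds h1).mono_right (nhds_le_uniformity _)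

end BatchQueue

/-! ### Services and arrivals acting on geometric sequences -/

theorem PMF.toReal_bind {α β : Type*} (p : PMF α) (f : α → PMF β) (x : β) :
    ((p.bind f) x).toReal = ∑' a, (p a).toReal * (f a x).toReal := by
  rw [PMF.bind_apply, ENNReal.tsum_toReal_eq]
  · simp_rw [ENNReal.toReal_mul]
  · exact fun a => ENNReal.mul_ne_top (p.apply_ne_top a) ((f a).apply_ne_top x)

theorem PMF.toReal_le_one {α : Type*} (p : PMF α) (x : α) : (p x).toReal ≤ 1 :=
  ENNReal.toReal_le_of_le_ofReal zero_le_one (by simpa using p.coe_le_one x)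

theorem tsum_mul_tsum_comm_of_le_one {v : ℕ → ℂ} (hv : Summable v) {a : ℕ → ℝ} (ha0 : ∀ k, 0 ≤ a k)
    (ha : Summable a) {f : ℕ → ℕ → ℝ} (hf0 : ∀ k n, 0 ≤ f k n) (hf1 : ∀ k n, f k n ≤ 1) :
    ∑' n, v n * ((∑' k, a k * f k n : ℝ) : ℂ) = ∑' k, (a k : ℂ) * ∑' n, v n * f k n := by
  have hsum : Summable (Function.uncurry fun n k => v n * ((a k : ℂ) * f k n)) := by
    refine Summable.of_norm_bounded (g := fun q : ℕ × ℕ => ‖v q.1‖ * a q.2)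
      (hv.norm.mul_of_nonneg ha (fun _ => norm_nonneg _) ha0) fun q => ?_
    simp only [Function.uncurry, norm_mul, Complex.norm_real]
    rw [Real.norm_of_nonneg (ha0 _), Real.norm_of_nonneg (hf0 _ _)]
    exact mul_le_mul_of_nonneg_left (mul_le_of_le_one_right (ha0 _) (hf1 _ _)) (norm_nonneg _)
  simp_rw [Complex.ofReal_tsum, Complex.ofReal_mul, ← tsum_mul_left]
  refine hsum.tsum_comm.symm.trans ?_
  refine tsum_congr fun k => tsum_congr fun n => ?_
  ring

namespace BatchQueue

variable (Q : BatchQueue)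

theorem serveIter_eq_bind (k : ℕ) (p : PMF ℕ) :
    Q.serveIter k p = p.bind fun n => Q.serveIter k (PMF.pure n) := by
  induction k generalizing p with
  | zero => simp [serveIter]
  | succ k ih =>
    have h : ∀ q : PMF ℕ, Q.serveIter (k + 1) q = Q.serveIter k (q.bind Q.serve) := fun q => rfl
    simp_rw [h, PMF.pure_bind]
    rw [ih, PMF.bind_bind]
    congr 1
    funext n
    exact (ih _).symm

/-- The probability that `k` services lead from `n` to `m` customers. -/
noncomputable def serveProb (k n m : ℕ) : ℝ := (Q.serveIter k (PMF.pure n) m).toReal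

theorem serveProb_nonneg (k n m : ℕ) : 0 ≤ Q.serveProb k n m := ENNReal.toReal_nonneg

theorem serveProb_le_one (k n m : ℕ) : Q.serveProb k n m ≤ 1 := PMF.toReal_le_one _ _

theorem serveIter_succ_pure (k n : ℕ) : Q.serveIter (k + 1) (PMF.pure n) =
    Q.y.bind fun j => Q.serveIter k (PMF.pure (n - min j n)) := by
  have h : Q.serveIter (k + 1) (PMF.pure n) = Q.serveIter k ((PMF.pure n).bind Q.serve) := rfl
  rw [h, PMF.pure_bind, serveIter_eq_bind, serve, PMF.bind_map]
  rfl

theorem serveProb_zero (n m : ℕ) : Q.serveProb 0 n m = if m = n then 1 else 0 := by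
  simp only [serveProb, serveIter, Function.iterate_zero, id, PMF.pure_apply]
  split_ifs <;> simp

theorem serveProb_succ (k n m : ℕ) :
    Q.serveProb (k + 1) n m = ∑' j, Q.yProb j * Q.serveProb k (n - min j n) m := by
  rw [serveProb, serveIter_succ_pure, PMF.toReal_bind]
  rfl

theorem serveProb_of_empty (k : ℕ) {m : ℕ} (hm : m ≠ 0) : Q.serveProb k 0 m = 0 := by
  induction k with
  | zero => simp [serveProb_zero, hm]
  | succ k ih => simp [serveProb_succ, ih]

theorem summable_pow_mul_serveProb (k m : ℕ) {r : ℂ} (hr : ‖r‖ < 1) (i : ℕ) :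
    Summable fun n => r ^ n * (Q.serveProb k (n + i) m : ℂ) := by
  refine Summable.of_norm_bounded (summable_geometric_of_norm_lt_one hr).norm fun n => ?_
  rw [norm_mul, Complex.norm_real, Real.norm_of_nonneg (Q.serveProb_nonneg _ _ _)]
  exact mul_le_of_le_one_right (norm_nonneg _) (Q.serveProb_le_one _ _ _)

/-- Away from the empty state, r^n is an eigenvector of one service with eigenvalue Y(r): removing j
customers is a shift, and the truncation min{j, n} only feeds state 0, which services cannot leave.
-/
theorem tsum_pow_mul_serveProb (k : ℕ) {m : ℕ} (hm : m ≠ 0) {r : ℂ} (hr : ‖r‖ < 1) :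
    ∑' n, r ^ n * (Q.serveProb k n m : ℂ) = Q.Y r ^ k * r ^ m := by
  induction k with
  | zero =>
    rw [tsum_eq_single m]
    · simp [serveProb_zero]
    · intro n hn
      simp [serveProb_zero, hn.symm]
  | succ k ih =>
    simp_rw [serveProb_succ]
    rw [tsum_mul_tsum_comm_of_le_one (summable_geometric_of_norm_lt_one hr) Q.yProb_nonneg
      Q.hasSum_yProb.summable (fun _ _ => Q.serveProb_nonneg _ _ _)
      (fun _ _ => Q.serveProb_le_one _ _ _)]
    have hstep : ∀ j, ∑' n, r ^ n * (Q.serveProb k (n - min j n) m : ℂ) =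
        r ^ j * (Q.Y r ^ k * r ^ m) := by
      intro j
      have hs : Summable fun n => r ^ n * (Q.serveProb k (n - min j n) m : ℂ) := by
        refine Summable.of_norm_bounded (summable_geometric_of_norm_lt_one hr).norm fun n => ?_
        rw [norm_mul, Complex.norm_real, Real.norm_of_nonneg (Q.serveProb_nonneg _ _ _)]
        exact mul_le_of_le_one_right (norm_nonneg _) (Q.serveProb_le_one _ _ _)
      -- The states n < j are emptied and contribute nothing to m ≠ 0; the others form the shifted
      -- series.
      rw [← hs.sum_add_tsum_nat_add j, Finset.sum_eq_zero, zero_add, ← ih, ← tsum_mul_left]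
      · refine tsum_congr fun n => ?_
        rw [show n + j - min j (n + j) = n by omega, pow_add]
        ring
      · intro n hn
        rw [Finset.mem_range] at hn
        rw [show n - min j n = 0 by omega, Q.serveProb_of_empty k hm]
        simp
    simp_rw [hstep, ← mul_assoc]
    rw [tsum_mul_right, tsum_mul_right, pow_succ', Y_eq]

/-- The probability that a batch arrives and `k` services are completed, leading from `n` to `m`
customers. -/
noncomputable def arriveServeProb (k n m : ℕ) : ℝ :=
  ∑ i ∈ Finset.Icc 1 Q.b, Q.gProb i * Q.serveProb k (n + i) m

theorem arriveServeProb_nonneg (k n m : ℕ) : 0 ≤ Q.arriveServeProb k n m :=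
  Finset.sum_nonneg fun i _ => mul_nonneg (Q.gProb_nonneg i) (Q.serveProb_nonneg _ _ _)

theorem arriveServeProb_le_one (k n m : ℕ) : Q.arriveServeProb k n m ≤ 1 := by
  rw [← Q.sum_gProb]
  exact Finset.sum_le_sum fun i _ =>
    mul_le_of_le_one_right (Q.gProb_nonneg i) (Q.serveProb_le_one _ _ _)

theorem tsum_mul_gProb (f : ℕ → ℝ) :
    ∑' i, Q.gProb i * f i = ∑ i ∈ Finset.Icc 1 Q.b, Q.gProb i * f i := by
  refine tsum_eq_sum fun i hi => ?_
  rw [Finset.mem_Icc, not_and_or] at hi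
  rcases hi with hi | hi
  · have : i = 0 := by omega
    simp [this, gProb, Q.g_zero]
  · simp [gProb, Q.g_large i (by omega)]

/-- Poisson probabilities of the number of services completed during a time `t`. -/
noncomputable def serviceProb (t : ℝ) (k : ℕ) : ℝ :=
  ((ProbabilityTheory.poissonMeasure (Q.mu * t).toNNReal).toPMF k).toReal

theorem serviceProb_nonneg (t : ℝ) (k : ℕ) : 0 ≤ Q.serviceProb t k := ENNReal.toReal_nonneg

theorem hasSum_serviceProb (t : ℝ) : HasSum (Q.serviceProb t) 1 := PMF.hasSum_toReal _

theorem serviceProb_eq {t : ℝ} (ht : 0 ≤ t) (k : ℕ) :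
    Q.serviceProb t k = Real.exp (-(Q.mu * t)) * (Q.mu * t) ^ k / k.factorial := by
  rw [serviceProb, Measure.toPMF_apply, ← measureReal_def,
    ProbabilityTheory.poissonMeasure_real_singleton, Real.coe_toNNReal _ (mul_nonneg Q.mu_pos.le ht)]

theorem tsum_serviceProb_mul_pow {t : ℝ} (ht : 0 ≤ t) (z : ℂ) :
    ∑' k, (Q.serviceProb t k : ℂ) * z ^ k = Complex.exp (-(Q.mu * (1 - z)) * t) := by
  have h : ∀ k, (Q.serviceProb t k : ℂ) * z ^ k =
      Complex.exp (-(Q.mu * t)) * ((Q.mu * t * z) ^ k / k.factorial) := by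
    intro k
    rw [Q.serviceProb_eq ht]
    push_cast
    rw [mul_pow _ z]
    ring
  simp_rw [h]
  rw [tsum_mul_left, (NormedSpace.expSeries_div_hasSum_exp (Q.mu * t * z : ℂ)).tsum_eq,
    ← Complex.exp_eq_exp_ℂ, ← Complex.exp_add]
  ring_nf

/-- Transition probabilities until a time `t` after an arrival, as real numbers. -/
noncomputable def afterProb (n : ℕ) (t : ℝ) (m : ℕ) : ℝ := (Q.afterArrival n t m).toReal

theorem afterProb_nonneg (n : ℕ) (t : ℝ) (m : ℕ) : 0 ≤ Q.afterProb n t m := ENNReal.toReal_nonneg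

theorem afterProb_le_one (n : ℕ) (t : ℝ) (m : ℕ) : Q.afterProb n t m ≤ 1 := PMF.toReal_le_one _ _

theorem afterArrival_eq (n : ℕ) (t : ℝ) : Q.afterArrival n t =
    (ProbabilityTheory.poissonMeasure (Q.mu * t).toNNReal).toPMF.bind fun k =>
      Q.g.bind fun i => Q.serveIter k (PMF.pure (n + i)) := by
  rw [afterArrival, PMF.bind_comm]

theorem afterProb_eq (n : ℕ) (t : ℝ) (m : ℕ) :
    Q.afterProb n t m = ∑' k, Q.serviceProb t k * Q.arriveServeProb k n m := by
  rw [afterProb, afterArrival_eq, PMF.toReal_bind]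
  refine tsum_congr fun k => ?_
  rw [PMF.toReal_bind, arriveServeProb, ← tsum_mul_gProb]
  rfl

theorem gRev_eq {r : ℂ} (hr : r ≠ 0) : Q.gRev r = Q.G r⁻¹ * r ^ Q.b := by
  rw [gRev, G, Finset.sum_mul]
  refine Finset.sum_congr rfl fun i hi => ?_
  rw [mul_assoc, inv_pow, pow_sub₀ _ hr (Finset.mem_Icc.1 hi).2]
  ring

section Geometric

variable {r κ : Fin Q.b → ℂ}

theorem summable_sum_mul_pow (hr : ∀ j, ‖r j‖ < 1) :
    Summable fun n : ℕ => ∑ j, κ j * r j ^ n :=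
  summable_sum fun j _ => (summable_geometric_of_norm_lt_one (hr j)).mul_left _

/-- An arrival of i customers turns r^n into r^(n-i), but only from level i upward. This is where
the homogeneous equations of the system are used: they cancel the missing terms below level i. -/
theorem tsum_mul_arriveServeProb (hr : ∀ j, ‖r j‖ < 1) (hr0 : ∀ j, r j ≠ 0)
    (hκ : ∀ k ∈ Finset.Icc 1 (Q.b - 1), ∑ j, κ j / r j ^ k = 0) (k : ℕ) {m : ℕ} (hm : m ≠ 0) :
    ∑' n, (∑ j, κ j * r j ^ n) * (Q.arriveServeProb k n m : ℂ) =
      ∑ j, κ j * Q.G (r j)⁻¹ * r j ^ m * Q.Y (r j) ^ k := by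
  have hshift : ∀ i j, ∑' n, r j ^ n * (Q.serveProb k (n + i) m : ℂ) = ((r j)⁻¹) ^ i *
      (Q.Y (r j) ^ k * r j ^ m - ∑ n ∈ Finset.range i, r j ^ n * (Q.serveProb k n m : ℂ)) := by
    intro i j
    have h := (Q.summable_pow_mul_serveProb k m (hr j) 0).sum_add_tsum_nat_add i
    simp only [add_zero] at h
    rw [Q.tsum_pow_mul_serveProb k hm (hr j)] at h
    rw [← h, add_sub_cancel_left, ← tsum_mul_left]
    refine tsum_congr fun n => ?_
    have := pow_ne_zero i (hr0 j)
    rw [pow_add, inv_pow]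
    field_simp
  -- For n = 0 the empty state never leads to m ≠ 0; for 1 ≤ n < i the inner sum is the equation
  -- with k = i - n, which is at most b - 1.
  have hzero : ∀ i ∈ Finset.Icc 1 Q.b, ∀ n ∈ Finset.range i,
      (Q.serveProb k n m : ℂ) * ∑ j, κ j * (((r j)⁻¹) ^ i * r j ^ n) = 0 := by
    intro i hi n hn
    rw [Finset.mem_Icc] at hi
    rw [Finset.mem_range] at hn
    rcases Nat.eq_zero_or_pos n with rfl | hn0
    · rw [Q.serveProb_of_empty k hm]; simp
    · rw [← mul_zero (Q.serveProb k n m : ℂ), ← hκ (i - n) (Finset.mem_Icc.2 (by omega))]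
      congr 1
      refine Finset.sum_congr rfl fun j _ => ?_
      rw [inv_pow, pow_sub₀ _ (hr0 j) hn.le]
      have h1 := pow_ne_zero i (hr0 j)
      have h2 := pow_ne_zero n (hr0 j)
      field_simp
  calc ∑' n, (∑ j, κ j * r j ^ n) * (Q.arriveServeProb k n m : ℂ)
      = ∑' n, ∑ j, ∑ i ∈ Finset.Icc 1 Q.b,
          κ j * Q.gProb i * (r j ^ n * (Q.serveProb k (n + i) m : ℂ)) := by
        refine tsum_congr fun n => ?_
        rw [arriveServeProb, Complex.ofReal_sum, Finset.sum_mul]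
        refine Finset.sum_congr rfl fun j _ => ?_
        rw [Finset.mul_sum]
        refine Finset.sum_congr rfl fun i _ => ?_
        push_cast
        ring
    _ = ∑ j, ∑ i ∈ Finset.Icc 1 Q.b,
          κ j * Q.gProb i * ∑' n, r j ^ n * (Q.serveProb k (n + i) m : ℂ) := by
        rw [Summable.tsum_finsetSum]
        · refine Finset.sum_congr rfl fun j _ => ?_
          rw [Summable.tsum_finsetSum]
          · simp_rw [tsum_mul_left]
          · exact fun i _ => (Q.summable_pow_mul_serveProb k m (hr j) i).mul_left _
        · exact fun j _ => summable_sum fun i _ =>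
            (Q.summable_pow_mul_serveProb k m (hr j) i).mul_left _
    _ = ∑ j, κ j * Q.G (r j)⁻¹ * r j ^ m * Q.Y (r j) ^ k -
          ∑ i ∈ Finset.Icc 1 Q.b, ∑ n ∈ Finset.range i,
            Q.gProb i * ((Q.serveProb k n m : ℂ) * ∑ j, κ j * (((r j)⁻¹) ^ i * r j ^ n)) := by
        have h1 : ∀ j, ∑ i ∈ Finset.Icc 1 Q.b, κ j * Q.gProb i *
            ∑' n, r j ^ n * (Q.serveProb k (n + i) m : ℂ) =
            κ j * Q.G (r j)⁻¹ * r j ^ m * Q.Y (r j) ^ k - ∑ i ∈ Finset.Icc 1 Q.b,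
              ∑ n ∈ Finset.range i,
                Q.gProb i * ((Q.serveProb k n m : ℂ) * (κ j * (((r j)⁻¹) ^ i * r j ^ n))) := by
          intro j
          rw [G, Finset.mul_sum, Finset.sum_mul, Finset.sum_mul, ← Finset.sum_sub_distrib]
          refine Finset.sum_congr rfl fun i _ => ?_
          rw [hshift, mul_sub, mul_sub, Finset.mul_sum, Finset.mul_sum]
          congr 1
          · rw [gProb]; ring
          · refine Finset.sum_congr rfl fun n _ => ?_
            ring
        simp_rw [h1]
        rw [Finset.sum_sub_distrib, Finset.sum_comm]
        congr 1
        refine Finset.sum_congr rfl fun i _ => ?_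
        rw [Finset.sum_comm]
        refine Finset.sum_congr rfl fun n _ => ?_
        rw [Finset.mul_sum, Finset.mul_sum]
    _ = _ := by
        rw [Finset.sum_eq_zero fun i hi => Finset.sum_eq_zero fun n hn => by
          rw [hzero i hi n hn, mul_zero], sub_zero]

theorem tsum_mul_afterProb (hr : ∀ j, ‖r j‖ < 1) (hr0 : ∀ j, r j ≠ 0)
    (hκ : ∀ k ∈ Finset.Icc 1 (Q.b - 1), ∑ j, κ j / r j ^ k = 0) {t : ℝ} (ht : 0 ≤ t) {m : ℕ}
    (hm : m ≠ 0) :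
    ∑' n, (∑ j, κ j * r j ^ n) * (Q.afterProb n t m : ℂ) =
      ∑ j, κ j * Q.G (r j)⁻¹ * r j ^ m * Complex.exp (-(Q.mu * (1 - Q.Y (r j))) * t) := by
  simp_rw [afterProb_eq]
  rw [tsum_mul_tsum_comm_of_le_one (Q.summable_sum_mul_pow hr) (Q.serviceProb_nonneg t)
    (Q.hasSum_serviceProb t).summable (fun _ _ => Q.arriveServeProb_nonneg _ _ _)
    (fun _ _ => Q.arriveServeProb_le_one _ _ _)]
  simp_rw [Q.tsum_mul_arriveServeProb hr hr0 hκ _ hm, Finset.mul_sum]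
  rw [Summable.tsum_finsetSum]
  · refine Finset.sum_congr rfl fun j _ => ?_
    rw [← Q.tsum_serviceProb_mul_pow ht, ← tsum_mul_left]
    refine tsum_congr fun k => ?_
    ring
  · intro j _
    have hY : ‖Q.Y (r j)‖ ≤ 1 := (Q.norm_Y_le (hr j).le).trans (hr j).le
    refine ((summable_ofReal_mul_pow (Q.serviceProb_nonneg t) (Q.hasSum_serviceProb t).summable
      hY).mul_left (κ j * Q.G (r j)⁻¹ * r j ^ m)).congr fun k => ?_
    ring

end Geometric

end BatchQueue

/-! ### Signed stationary sequences of a Markov kernel -/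

section Stationary

variable {K : ℕ → ℕ → ℝ}

theorem summable_uncurry_mul_kernel (h0 : ∀ n m, 0 ≤ K n m) (h1 : ∀ n, HasSum (K n) 1) {a : ℕ → ℝ}
    (ha0 : ∀ n, 0 ≤ a n) (ha : Summable a) : Summable (Function.uncurry fun n m => a n * K n m) := by
  have h : Summable fun q : ℕ × ℕ => a q.1 * K q.1 q.2 := by
    rw [summable_prod_of_nonneg fun q : ℕ × ℕ => mul_nonneg (ha0 q.1) (h0 q.1 q.2)]
    refine ⟨fun n => (h1 n).summable.mul_left (a n), ?_⟩
    simp_rw [tsum_mul_left, (h1 _).tsum_eq, mul_one]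
    exact ha
  exact h

/-- |σ| is dominated termwise by |σ|K, and both have the same total, so they agree at 0. Equality in
the triangle inequality for ∑ σ_n K(n, 0), with every K(n, 0) > 0, forces one common sign. -/
theorem nonneg_or_nonpos_of_stationary (h0 : ∀ n m, 0 ≤ K n m) (h1 : ∀ n, HasSum (K n) 1)
    (hpos : ∀ n, 0 < K n 0) {σ : ℕ → ℝ} (hσ : Summable σ) (hst : ∀ m, σ m = ∑' n, σ n * K n m) :
    (∀ n, 0 ≤ σ n) ∨ ∀ n, σ n ≤ 0 := by
  have habs : Summable (Function.uncurry fun n m => |σ n| * K n m) :=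
    summable_uncurry_mul_kernel h0 h1 (fun n => abs_nonneg _) hσ.abs
  have hrow : ∀ m, Summable fun n => |σ n| * K n m := fun m =>
    habs.prod_symm.prod_factor m
  have hrow' : ∀ m, Summable fun n => σ n * K n m := fun m => by
    refine Summable.of_norm_bounded (hrow m) fun n => ?_
    rw [norm_mul, Real.norm_eq_abs, Real.norm_of_nonneg (h0 n m)]
  have hle : ∀ m, |σ m| ≤ ∑' n, |σ n| * K n m := by
    intro m
    rw [hst m, ← Real.norm_eq_abs]
    refine tsum_of_norm_bounded (hrow m).hasSum fun n => ?_
    rw [norm_mul, Real.norm_eq_abs, Real.norm_of_nonneg (h0 n m)]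
  have htot : ∑' m, ∑' n, |σ n| * K n m = ∑' n, |σ n| := by
    rw [habs.tsum_comm]
    simp [tsum_mul_left, (h1 _).tsum_eq]
  have hsumm : Summable fun m => ∑' n, |σ n| * K n m := habs.prod_symm.prod
  have heq : |σ 0| = ∑' n, |σ n| * K n 0 := by
    refine le_antisymm (hle 0) ?_
    by_contra! hlt
    exact (hσ.abs.tsum_lt_tsum hle hlt hsumm).ne htot.symm
  rcases le_total 0 (σ 0) with hs | hs
  · left
    rw [abs_of_nonneg hs, hst 0] at heq
    have hz : ∑' n, (|σ n| * K n 0 - σ n * K n 0) = 0 := by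
      rw [(hrow 0).tsum_sub (hrow' 0), heq, sub_self]
    have hz' := (hasSum_zero_iff_of_nonneg fun n => by
      rw [← sub_mul]
      exact mul_nonneg (sub_nonneg.2 (le_abs_self _)) (h0 _ _)).1
      (hz ▸ ((hrow 0).sub (hrow' 0)).hasSum)
    intro n
    have := congrFun hz' n
    simp only [Pi.zero_apply, ← sub_mul, mul_eq_zero, (hpos n).ne', or_false, sub_eq_zero] at this
    exact this ▸ abs_nonneg _
  · right
    rw [abs_of_nonpos hs, hst 0] at heq
    have hz : ∑' n, (|σ n| * K n 0 + σ n * K n 0) = 0 := by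
      rw [(hrow 0).tsum_add (hrow' 0), ← heq]
      ring
    have hz' := (hasSum_zero_iff_of_nonneg fun n => by
      rw [← add_mul]
      exact mul_nonneg (by linarith [neg_abs_le (σ n)]) (h0 _ _)).1
      (hz ▸ ((hrow 0).add (hrow' 0)).hasSum)
    intro n
    have := congrFun hz' n
    simp only [Pi.zero_apply, ← add_mul, mul_eq_zero, (hpos n).ne', or_false] at this
    linarith [abs_nonneg (σ n)]

theorem eq_zero_of_stationary (h0 : ∀ n m, 0 ≤ K n m) (h1 : ∀ n, HasSum (K n) 1)
    (hpos : ∀ n, 0 < K n 0) {σ : ℕ → ℝ} (hσ : HasSum σ 0) (hst : ∀ m, σ m = ∑' n, σ n * K n m) :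
    σ = 0 := by
  rcases nonneg_or_nonpos_of_stationary h0 h1 hpos hσ.summable hst with h | h
  · exact (hasSum_zero_iff_of_nonneg h).1 hσ
  · have h' : HasSum (fun n => -σ n) 0 := by simpa using hσ.neg
    have := (hasSum_zero_iff_of_nonneg fun n => neg_nonneg.2 (h n)).1 h'
    funext n
    simpa using congrFun this n

/-- The kernel preserves total mass, so the defects of the stationary equations sum to zero, and a
single unknown defect must vanish. This spares a direct computation at the empty state. -/
theorem stationary_of_ne_zero (h0 : ∀ n m, 0 ≤ K n m) (h1 : ∀ n, HasSum (K n) 1) {v : ℕ → ℂ}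
    (hv : Summable v) (hst : ∀ m, m ≠ 0 → v m = ∑' n, v n * K n m) (m : ℕ) :
    v m = ∑' n, v n * K n m := by
  rcases eq_or_ne m 0 with rfl | hm
  · have hs : Summable (Function.uncurry fun n m => v n * (K n m : ℂ)) := by
      refine Summable.of_norm_bounded
        (summable_uncurry_mul_kernel h0 h1 (fun n => norm_nonneg (v n)) hv.norm) fun q => ?_
      simp only [Function.uncurry, norm_mul, Complex.norm_real, Real.norm_of_nonneg (h0 _ _), le_refl]
    have htot : ∑' m, ∑' n, v n * (K n m : ℂ) = ∑' n, v n := by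
      rw [hs.tsum_comm]
      refine tsum_congr fun n => ?_
      rw [tsum_mul_left, ← Complex.ofReal_tsum, (h1 n).tsum_eq, Complex.ofReal_one, mul_one]
    have hsumm : Summable fun m => ∑' n, v n * (K n m : ℂ) := hs.prod_symm.prod
    have hd : ∑' m, (v m - ∑' n, v n * (K n m : ℂ)) = 0 := by
      rw [hv.tsum_sub hsumm, htot, sub_self]
    rw [tsum_eq_single 0 fun m hm => by rw [← hst m hm, sub_self]] at hd
    exact sub_eq_zero.1 hd
  · exact hst m hm

end Stationary

/-! ### The embedded chain at arrivals and its uniqueness property -/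

namespace BatchQueue

variable (Q : BatchQueue)

theorem measurable_afterArrival (n m : ℕ) : Measurable fun t : ℝ => Q.afterArrival n t m := by
  simp_rw [afterArrival_eq, PMF.bind_apply]
  refine Measurable.tsum fun k => Measurable.mul_const ?_ _
  simp_rw [Measure.toPMF_apply, ProbabilityTheory.poissonMeasure_singleton]
  fun_prop

/-- Transition probabilities from an arrival on, integrated over the elapsed time. -/
noncomputable def avgKernel (ν : Measure ℝ) (n m : ℕ) : ENNReal := ∫⁻ t, Q.afterArrival n t m ∂ν

theorem tsum_avgKernel (ν : Measure ℝ) (n : ℕ) : ∑' m, Q.avgKernel ν n m = ν Set.univ := by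
  simp_rw [avgKernel]
  rw [← lintegral_tsum fun m => (Q.measurable_afterArrival n m).aemeasurable]
  simp [PMF.tsum_coe]

theorem avgKernel_ne_top (ν : Measure ℝ) [IsFiniteMeasure ν] (n m : ℕ) : Q.avgKernel ν n m ≠ ⊤ :=
  ne_top_of_le_ne_top (measure_ne_top ν Set.univ)
    ((ENNReal.le_tsum m).trans (Q.tsum_avgKernel ν n).le)

theorem toReal_avgKernel (ν : Measure ℝ) (n m : ℕ) :
    (Q.avgKernel ν n m).toReal = ∫ t, Q.afterProb n t m ∂ν := by
  rw [avgKernel]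
  exact (integral_toReal (Q.measurable_afterArrival n m).aemeasurable
    (Eventually.of_forall fun t => ((Q.afterArrival n t).apply_lt_top m))).symm

theorem integrable_afterProb (ν : Measure ℝ) [IsFiniteMeasure ν] (n m : ℕ) :
    Integrable (fun t => Q.afterProb n t m) ν := by
  refine Integrable.of_bound (C := 1)
    (Q.measurable_afterArrival n m).ennreal_toReal.aestronglyMeasurable ?_
  refine Eventually.of_forall fun t => ?_
  rw [Real.norm_of_nonneg (Q.afterProb_nonneg _ _ _)]
  exact Q.afterProb_le_one _ _ _

/-- The measure is left free so that one computation serves both the inter-arrival law (pre-arrival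
epochs) and `ageMeasure` (arbitrary epochs). -/
theorem tsum_mul_avgKernel {r κ : Fin Q.b → ℂ} (hr : ∀ j, ‖r j‖ < 1) (hr0 : ∀ j, r j ≠ 0)
    (hκ : ∀ k ∈ Finset.Icc 1 (Q.b - 1), ∑ j, κ j / r j ^ k = 0) (ν : Measure ℝ) [IsFiniteMeasure ν]
    (hν : ∀ᵐ t ∂ν, 0 < t) {m : ℕ} (hm : m ≠ 0) :
    ∑' n, (∑ j, κ j * r j ^ n) * ((Q.avgKernel ν n m).toReal : ℂ) =
      ∑ j, κ j * Q.G (r j)⁻¹ * r j ^ m *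
        ∫ t : ℝ, Complex.exp (-(Q.mu * (1 - Q.Y (r j))) * t) ∂ν := by
  have hexp : ∀ j, Integrable (fun t : ℝ => Complex.exp (-(Q.mu * (1 - Q.Y (r j))) * t)) ν := by
    intro j
    have hre : 0 ≤ (Q.mu * (1 - Q.Y (r j)) : ℂ).re := by
      have h1 : (Q.Y (r j)).re ≤ 1 :=
        (Complex.re_le_norm _).trans ((Q.norm_Y_le (hr j).le).trans (hr j).le)
      simpa using mul_nonneg Q.mu_pos.le (by linarith : 0 ≤ 1 - (Q.Y (r j)).re)
    refine Integrable.of_bound (C := 1) (by fun_prop) ?_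
    filter_upwards [hν] with t ht using norm_exp_neg_mul_ofReal_le hre ht.le
  have hnorm : Summable fun n => ‖∑ j, κ j * r j ^ n‖ := (Q.summable_sum_mul_pow hr).norm
  calc ∑' n, (∑ j, κ j * r j ^ n) * ((Q.avgKernel ν n m).toReal : ℂ)
      = ∑' n, ∫ t, (∑ j, κ j * r j ^ n) * (Q.afterProb n t m : ℂ) ∂ν := by
        refine tsum_congr fun n => ?_
        rw [integral_const_mul, toReal_avgKernel, integral_complex_ofReal]
    _ = ∫ t, ∑' n, (∑ j, κ j * r j ^ n) * (Q.afterProb n t m : ℂ) ∂ν := by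
        refine integral_tsum_of_summable_integral_norm
          (fun n => (Q.integrable_afterProb ν n m).ofReal.const_mul _) ?_
        refine Summable.of_nonneg_of_le (fun n => integral_nonneg fun t => norm_nonneg _)
          (fun n => ?_) (hnorm.mul_right (ν.real Set.univ))
        calc ∫ t, ‖(∑ j, κ j * r j ^ n) * (Q.afterProb n t m : ℂ)‖ ∂ν
            ≤ ∫ t, ‖∑ j, κ j * r j ^ n‖ ∂ν := by
              refine integral_mono_of_nonneg (Eventually.of_forall fun t => norm_nonneg _)
                (integrable_const _) (Eventually.of_forall fun t => ?_)
              simp only [norm_mul, Complex.norm_real]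
              rw [Real.norm_of_nonneg (Q.afterProb_nonneg _ _ _)]
              exact mul_le_of_le_one_right (norm_nonneg _) (Q.afterProb_le_one _ _ _)
          _ = _ := by simp [mul_comm]
    _ = ∫ t : ℝ, ∑ j, κ j * Q.G (r j)⁻¹ * r j ^ m *
          Complex.exp (-(Q.mu * (1 - Q.Y (r j))) * t) ∂ν := by
        refine integral_congr_ae ?_
        filter_upwards [hν] with t ht using Q.tsum_mul_afterProb hr hr0 hκ ht.le hm
    _ = _ := by
        rw [integral_finsetSum _ fun j _ => (hexp j).const_mul _]
        simp_rw [integral_const_mul]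

/-- Transition probabilities of the embedded chain at pre-arrival epochs. -/
noncomputable def preKernel (n m : ℕ) : ℝ := (Q.avgKernel Q.law n m).toReal

theorem preKernel_nonneg (n m : ℕ) : 0 ≤ Q.preKernel n m := ENNReal.toReal_nonneg

theorem hasSum_preKernel (n : ℕ) : HasSum (Q.preKernel n) 1 := by
  have h := ENNReal.hasSum_toReal (f := Q.avgKernel Q.law n)
    (by rw [tsum_avgKernel]; exact measure_ne_top _ _)
  rwa [← ENNReal.tsum_toReal_eq fun m => Q.avgKernel_ne_top _ n m, tsum_avgKernel, measure_univ,
    ENNReal.toReal_one] at h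

theorem serveIter_pure_apply_zero_ne_zero (k : ℕ) {n : ℕ} (hn : n ≤ k) :
    Q.serveIter k (PMF.pure n) 0 ≠ 0 := by
  induction k generalizing n with
  | zero =>
    have : n = 0 := by omega
    subst this
    simp [serveIter]
  | succ k ih =>
    obtain ⟨j, hj⟩ := Q.y.support_nonempty
    rw [PMF.mem_support_iff] at hj
    have hj0 : j ≠ 0 := fun h => hj (h ▸ Q.y_zero)
    rw [serveIter_succ_pure, PMF.bind_apply]
    exact ENNReal.summable.tsum_ne_zero_iff.2 ⟨j, mul_ne_zero hj (ih (by omega))⟩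

theorem afterArrival_apply_zero_ne_zero (n : ℕ) {t : ℝ} (ht : 0 < t) :
    Q.afterArrival n t 0 ≠ 0 := by
  rw [afterArrival, PMF.bind_apply]
  refine ENNReal.summable.tsum_ne_zero_iff.2 ⟨Q.b, mul_ne_zero Q.g_top ?_⟩
  rw [PMF.bind_apply]
  refine ENNReal.summable.tsum_ne_zero_iff.2 ⟨n + Q.b, mul_ne_zero ?_
    (Q.serveIter_pure_apply_zero_ne_zero _ le_rfl)⟩
  rw [Measure.toPMF_apply]
  intro h
  have := ProbabilityTheory.poissonMeasure_real_singleton_pos (n + Q.b)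
    (Real.toNNReal_pos.2 (mul_pos Q.mu_pos ht))
  rw [measureReal_def, h, ENNReal.toReal_zero] at this
  exact lt_irrefl _ this

/-- Each service of a nonempty system removes at least one customer, so n + b services empty it
after a batch of size b, and this many occur with positive probability. -/
theorem preKernel_zero_pos (n : ℕ) : 0 < Q.preKernel n 0 := by
  refine ENNReal.toReal_pos ?_ (Q.avgKernel_ne_top _ n 0)
  intro h
  rw [avgKernel, lintegral_eq_zero_iff (Q.measurable_afterArrival n 0)] at h
  obtain ⟨t, h1, h2⟩ := (h.and Q.ae_law_pos).exists
  exact Q.afterArrival_apply_zero_ne_zero n h2 h1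

theorem isPreArrivalDist_iff (π : PMF ℕ) : Q.IsPreArrivalDist π ↔
    ∀ m, (π m).toReal = ∑' n, (π n).toReal * Q.preKernel n m := by
  refine forall_congr' fun m => ?_
  have hne : ∀ n, π n * Q.avgKernel Q.law n m ≠ ⊤ := fun n =>
    ENNReal.mul_ne_top (π.apply_ne_top n) (Q.avgKernel_ne_top _ n m)
  have hle : ∑' n, π n * Q.avgKernel Q.law n m ≠ ⊤ := by
    refine ne_top_of_le_ne_top ENNReal.one_ne_top (b := 1) ?_
    rw [← π.tsum_coe]
    refine ENNReal.tsum_le_tsum fun n => mul_le_of_le_one_right (zero_le) ?_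
    refine (ENNReal.le_tsum m).trans ?_
    rw [tsum_avgKernel, measure_univ]
  have h : (∑' n, π n * Q.avgKernel Q.law n m).toReal = ∑' n, (π n).toReal * Q.preKernel n m := by
    rw [ENNReal.tsum_toReal_eq hne]
    simp_rw [ENNReal.toReal_mul]
    rfl
  rw [← h, ENNReal.toReal_eq_toReal_iff' (π.apply_ne_top m) hle]
  rfl

theorem IsPreArrivalDist.unique {π π' : PMF ℕ} (h : Q.IsPreArrivalDist π)
    (h' : Q.IsPreArrivalDist π') : π' = π := by
  rw [isPreArrivalDist_iff] at h h'
  have hs : ∀ (p : PMF ℕ) (m : ℕ), Summable fun n => (p n).toReal * Q.preKernel n m := fun p m =>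
    Summable.of_nonneg_of_le
      (fun n => mul_nonneg ENNReal.toReal_nonneg (Q.preKernel_nonneg n m))
      (fun n => mul_le_of_le_one_right ENNReal.toReal_nonneg
        (by simpa [(Q.hasSum_preKernel n).tsum_eq] using
          (Q.hasSum_preKernel n).summable.le_tsum m fun i _ => Q.preKernel_nonneg n i))
      p.hasSum_toReal.summable
  have hz := eq_zero_of_stationary (K := Q.preKernel) Q.preKernel_nonneg Q.hasSum_preKernel
    Q.preKernel_zero_pos (σ := fun n => (π' n).toReal - (π n).toReal)
    (by simpa using π'.hasSum_toReal.sub π.hasSum_toReal) (fun m => by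
      simp_rw [sub_mul]
      rw [(hs π' m).tsum_sub (hs π m), ← h m, ← h' m])
  ext n
  have := congrFun hz n
  simp only [Pi.zero_apply, sub_eq_zero] at this
  exact (ENNReal.toReal_eq_toReal_iff' (π'.apply_ne_top n) (π.apply_ne_top n)).1 this

/-! ### The elapsed inter-arrival time -/

section Age

theorem measurableSet_age : MeasurableSet {q : ℝ × ℝ | 0 < q.2 ∧ q.2 ≤ q.1} :=
  (measurableSet_lt measurable_const measurable_snd).inter
    (measurableSet_le measurable_snd measurable_fst)

/-- The law of the elapsed inter-arrival time, weighted by the mean inter-arrival time: the image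
of `dx ↦ law` times Lebesgue measure, restricted to `0 < t ≤ x`, under `(x, t) ↦ t`. -/
noncomputable def ageMeasure : Measure ℝ :=
  ((Q.law.prod volume).restrict {q : ℝ × ℝ | 0 < q.2 ∧ q.2 ≤ q.1}).map Prod.snd

theorem lintegral_ageMeasure {f : ℝ → ENNReal} (hf : Measurable f) :
    ∫⁻ t, f t ∂Q.ageMeasure = ∫⁻ x, (∫⁻ t in Set.Ioc 0 x, f t) ∂Q.law := by
  rw [ageMeasure, lintegral_map hf measurable_snd, ← lintegral_indicator measurableSet_age,
    lintegral_prod (Set.indicator _ fun q : ℝ × ℝ => f q.2)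
      ((hf.comp measurable_snd).indicator measurableSet_age).aemeasurable]
  refine lintegral_congr fun x => ?_
  rw [← lintegral_indicator measurableSet_Ioc]
  rfl

theorem ageMeasure_univ : Q.ageMeasure Set.univ = ∫⁻ x, ENNReal.ofReal x ∂Q.law := by
  rw [← lintegral_one, Q.lintegral_ageMeasure measurable_const]
  simp

theorem lintegral_ofReal_law : ∫⁻ x, ENNReal.ofReal x ∂Q.law = ENNReal.ofReal (1 / Q.lam) := by
  rw [← ofReal_integral_eq_lintegral_ofReal Q.law_mean (Q.ae_law_pos.mono fun x hx => hx.le), lam,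
    one_div, inv_inv]

instance : IsFiniteMeasure Q.ageMeasure :=
  ⟨by rw [ageMeasure_univ, lintegral_ofReal_law]; exact ENNReal.ofReal_lt_top⟩

theorem ae_ageMeasure_pos : ∀ᵐ t ∂Q.ageMeasure, 0 < t := by
  rw [ageMeasure, ae_map_iff measurable_snd.aemeasurable measurableSet_Ioi]
  exact (ae_restrict_mem measurableSet_age).mono fun q hq => hq.1

theorem integral_exp_ageMeasure {θ : ℂ} (hθ : 0 < θ.re) :
    ∫ t : ℝ, Complex.exp (-θ * t) ∂Q.ageMeasure = (1 - Q.lst θ) / θ := by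
  have hθ0 : θ ≠ 0 := by rintro rfl; simp at hθ
  set f : ℝ → ℂ := fun t => Complex.exp (-θ * t) with hf
  have hfm : Measurable f := by fun_prop
  have hint : Integrable f Q.ageMeasure := by
    refine Integrable.of_bound (C := 1) hfm.aestronglyMeasurable ?_
    filter_upwards [Q.ae_ageMeasure_pos] with t ht using norm_exp_neg_mul_ofReal_le hθ.le ht.le
  have hint' : IntegrableOn (fun q : ℝ × ℝ => f q.2) {q : ℝ × ℝ | 0 < q.2 ∧ q.2 ≤ q.1}
      (Q.law.prod volume) := hint.comp_measurable measurable_snd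
  have hinner : ∀ x : ℝ, 0 < x → ∫ t in Set.Ioc 0 x, f t = (1 - Complex.exp (-θ * x)) / θ := by
    intro x hx
    rw [← intervalIntegral.integral_of_le hx.le, hf, integral_exp_mul_complex (neg_ne_zero.2 hθ0)]
    simp only [Complex.ofReal_zero, mul_zero, Complex.exp_zero]
    field_simp
    ring
  rw [ageMeasure, integral_map measurable_snd.aemeasurable hfm.aestronglyMeasurable,
    ← integral_indicator measurableSet_age,
    integral_prod _ ((integrable_indicator_iff measurableSet_age).2 hint')]
  calc ∫ x, (∫ t, Set.indicator {q : ℝ × ℝ | 0 < q.2 ∧ q.2 ≤ q.1} (fun q => f q.2) (x, t)) ∂Q.law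
      = ∫ x : ℝ, (1 - Complex.exp (-θ * x)) / θ ∂Q.law := by
        refine integral_congr_ae ?_
        filter_upwards [Q.ae_law_pos] with x hx
        rw [← hinner x hx, ← integral_indicator measurableSet_Ioc]
        rfl
    _ = _ := by
        rw [integral_div, integral_sub (integrable_const _) (Q.integrable_exp_neg_mul hθ.le)]
        simp [lst]

end Age

/-! ### Identifying the limits as distributions of the queue -/

section Roots

variable {Q} {r c : Fin Q.b → ℂ}

theorem ListsZeros.norm_lt {b : ℕ} {f : ℂ → ℂ} {r : Fin b → ℂ} (h : ListsZeros f r) (j : Fin b) :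
    ‖r j‖ < 1 := ((h.2 _).1 ⟨j, rfl⟩).1

theorem ListsZeros.apply_eq_zero {b : ℕ} {f : ℂ → ℂ} {r : Fin b → ℂ} (h : ListsZeros f r)
    (j : Fin b) : f (r j) = 0 := ((h.2 _).1 ⟨j, rfl⟩).2

theorem ListsZeros.ne_zero {b : ℕ} {f : ℂ → ℂ} {r : Fin b → ℂ} (h : ListsZeros f r) (hf : f 0 ≠ 0)
    (j : Fin b) : r j ≠ 0 := fun h0 => hf (h0 ▸ h.apply_eq_zero j)

theorem ListsZeros.ne_one {b : ℕ} {f : ℂ → ℂ} {r : Fin b → ℂ} (h : ListsZeros f r) (j : Fin b) :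
    r j ≠ 1 := fun h1 => by simpa [h1] using h.norm_lt j

/-- The characteristic equation divided by r^b: over one inter-arrival cycle the mode r^n has
eigenvalue one. -/
theorem ListsZeros.G_mul_lst (h : ListsZeros Q.contChar r) (j : Fin Q.b) :
    Q.G (r j)⁻¹ * Q.lst (Q.mu * (1 - Q.Y (r j))) = 1 := by
  have h0 := h.ne_zero Q.contChar_zero_ne_zero j
  have h1 := h.apply_eq_zero j
  rw [contChar, Q.gRev_eq h0] at h1
  have h2 := pow_ne_zero Q.b h0
  apply mul_right_cancel₀ h2
  linear_combination h1

theorem preFormula_eq (l : ℝ) (n : ℕ) :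
    preFormula l r c n = ∑ j, (1 / (l : ℂ) * c j) * r j ^ n := by
  rw [preFormula, Finset.mul_sum]
  simp_rw [mul_assoc]

theorem SolvesSystem.sum_scaled {l : ℝ} (h : SolvesSystem l r c) :
    ∀ k ∈ Finset.Icc 1 (Q.b - 1), ∑ j, (1 / (l : ℂ) * c j) / r j ^ k = 0 := by
  intro k hk
  simp_rw [mul_div_assoc, ← Finset.mul_sum, h.1 k hk, mul_zero]

theorem hasSum_preFormula {l : ℝ} (hl : l ≠ 0) (hr : ∀ j, ‖r j‖ < 1) (h : SolvesSystem l r c) :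
    HasSum (preFormula l r c) 1 := by
  have h1 : HasSum (fun n => ∑ j, (1 / (l : ℂ) * c j) * r j ^ n)
      (∑ j, (1 / (l : ℂ) * c j) * (1 - r j)⁻¹) :=
    hasSum_sum fun j _ => (hasSum_geometric_of_norm_lt_one (hr j)).mul_left _
  have h2 : ∑ j, (1 / (l : ℂ) * c j) * (1 - r j)⁻¹ = 1 := by
    have hl' : (l : ℂ) ≠ 0 := by exact_mod_cast hl
    simp_rw [mul_assoc, ← div_eq_mul_inv, ← Finset.mul_sum, h.2]
    field_simp
  rw [h2] at h1
  exact h1.congr_fun fun n => preFormula_eq l n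

/-- The formula is a complex stationary sequence of total mass one. The kernel is real, so its real
and imaginary parts are stationary too; the imaginary part has mass zero and vanishes, and the real
part has mass one and constant sign. No information on individual roots is needed. -/
theorem exists_isPreArrivalDist (hr : ListsZeros Q.contChar r) (hc : SolvesSystem Q.lam r c) :
    ∃ π : PMF ℕ, Q.IsPreArrivalDist π ∧ ∀ n, preFormula Q.lam r c n = ((π n).toReal : ℂ) := by
  have hr0 := hr.ne_zero Q.contChar_zero_ne_zero
  set v := preFormula Q.lam r c with hv
  have hsum : HasSum v 1 := hasSum_preFormula Q.lam_pos.ne' hr.norm_lt hc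
  have hst : ∀ m, v m = ∑' n, v n * Q.preKernel n m := by
    refine stationary_of_ne_zero Q.preKernel_nonneg Q.hasSum_preKernel hsum.summable fun m hm => ?_
    simp_rw [hv, preFormula_eq, preKernel]
    rw [Q.tsum_mul_avgKernel hr.norm_lt hr0 hc.sum_scaled Q.law Q.ae_law_pos hm]
    refine Finset.sum_congr rfl fun j _ => ?_
    have := hr.G_mul_lst j
    rw [lst] at this
    linear_combination -(1 / (Q.lam : ℂ) * c j * r j ^ m) * this
  have hs : ∀ m, Summable fun n => v n * (Q.preKernel n m : ℂ) := fun m => by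
    refine Summable.of_norm_bounded hsum.summable.norm fun n => ?_
    rw [norm_mul, Complex.norm_real, Real.norm_of_nonneg (Q.preKernel_nonneg n m)]
    refine mul_le_of_le_one_right (norm_nonneg _) ?_
    rw [← (Q.hasSum_preKernel n).tsum_eq]
    exact (Q.hasSum_preKernel n).summable.le_tsum m fun i _ => Q.preKernel_nonneg n i
  have hre : ∀ m, (v m).re = ∑' n, (v n).re * Q.preKernel n m := fun m => by
    have h := congrArg Complex.re (hst m)
    rw [Complex.re_tsum (hs m)] at h
    simpa using h
  have him : ∀ m, (v m).im = ∑' n, (v n).im * Q.preKernel n m := fun m => by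
    have h := congrArg Complex.im (hst m)
    rw [Complex.im_tsum (hs m)] at h
    simpa using h
  have him0 : (fun n => (v n).im) = 0 :=
    eq_zero_of_stationary Q.preKernel_nonneg Q.hasSum_preKernel Q.preKernel_zero_pos
      (by simpa using Complex.hasSum_im hsum) him
  have hre1 : HasSum (fun n => (v n).re) 1 := by simpa using Complex.hasSum_re hsum
  have hnn : ∀ n, 0 ≤ (v n).re := by
    rcases nonneg_or_nonpos_of_stationary Q.preKernel_nonneg Q.hasSum_preKernel
      Q.preKernel_zero_pos hre1.summable hre with h | h
    · exact h
    · have := hre1.tsum_eq ▸ tsum_nonpos h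
      exact absurd this (by norm_num)
  let π : PMF ℕ := ⟨fun n => ENNReal.ofReal (v n).re, by
    rw [ENNReal.summable.hasSum_iff, ← ENNReal.ofReal_tsum_of_nonneg hnn hre1.summable,
      hre1.tsum_eq, ENNReal.ofReal_one]⟩
  have hπ : ∀ n, (π n).toReal = (v n).re := fun n => ENNReal.toReal_ofReal (hnn n)
  refine ⟨π, ?_, fun n => ?_⟩
  · rw [isPreArrivalDist_iff]
    simpa only [hπ] using hre
  · rw [hπ]
    exact Complex.ext (by simp) (by simpa using congrFun him0 n)

/-- Under `ageMeasure` the exponential integrates to (1 - A*(θ))/θ with θ = μ(1 - Y(r)), and G(1/r)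
A*(θ) = 1 turns G(1/r)(1 - A*(θ)) into G(1/r) - 1. The formula at 0 is then the complement of the
geometric sum over m ≥ 1. -/
theorem exists_isArbitraryEpochDist (hr : ListsZeros Q.contChar r) (hc : SolvesSystem Q.lam r c)
    {π : PMF ℕ} (hπ : ∀ n, preFormula Q.lam r c n = ((π n).toReal : ℂ)) :
    ∃ p : PMF ℕ, Q.IsArbitraryEpochDist π p ∧
      (∀ n : ℕ, 1 ≤ n → Q.contArb r c n = ((p n).toReal : ℂ)) ∧
      Q.contArbZero r c = ((p 0).toReal : ℂ) := by
  have hr0 := hr.ne_zero Q.contChar_zero_ne_zero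
  have hlam : (Q.lam : ℂ) ≠ 0 := by exact_mod_cast Q.lam_pos.ne'
  have hM : Q.ageMeasure Set.univ = ENNReal.ofReal (1 / Q.lam) := by
    rw [ageMeasure_univ, lintegral_ofReal_law]
  have hM0 : Q.ageMeasure Set.univ ≠ 0 := by
    rw [hM, Ne, ENNReal.ofReal_eq_zero, not_le]
    exact one_div_pos.2 Q.lam_pos
  let p : PMF ℕ := ⟨fun m => (∑' n, π n * Q.avgKernel Q.ageMeasure n m) / Q.ageMeasure Set.univ, by
    rw [ENNReal.summable.hasSum_iff]
    simp_rw [div_eq_mul_inv]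
    rw [ENNReal.tsum_mul_right, ENNReal.tsum_comm]
    simp_rw [ENNReal.tsum_mul_left, tsum_avgKernel]
    rw [ENNReal.tsum_mul_right, π.tsum_coe, one_mul,
      ENNReal.mul_inv_cancel hM0 (measure_ne_top _ _)]⟩
  have hpos : ∀ n : ℕ, 1 ≤ n → Q.contArb r c n = ((p n).toReal : ℂ) := by
    intro m hm
    have h1 : (p m).toReal =
        (∑' n, (π n).toReal * (Q.avgKernel Q.ageMeasure n m).toReal) * Q.lam := by
      change ((∑' n, π n * Q.avgKernel Q.ageMeasure n m) / Q.ageMeasure Set.univ).toReal = _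
      rw [ENNReal.toReal_div, ENNReal.tsum_toReal_eq fun n =>
        ENNReal.mul_ne_top (π.apply_ne_top n) (Q.avgKernel_ne_top _ n m), hM,
        ENNReal.toReal_ofReal (one_div_pos.2 Q.lam_pos).le, div_div_eq_mul_div, div_one]
      simp_rw [ENNReal.toReal_mul]
    rw [h1, Complex.ofReal_mul, Complex.ofReal_tsum]
    simp_rw [Complex.ofReal_mul, ← hπ, preFormula_eq]
    rw [Q.tsum_mul_avgKernel hr.norm_lt hr0 hc.sum_scaled Q.ageMeasure Q.ae_ageMeasure_pos
      (Nat.one_le_iff_ne_zero.1 hm), Finset.sum_mul, contArb]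
    refine Finset.sum_congr rfl fun j _ => ?_
    have hre : 0 < (Q.mu * (1 - Q.Y (r j)) : ℂ).re := by
      have h1 : (Q.Y (r j)).re < 1 :=
        (Complex.re_le_norm _).trans_lt ((Q.norm_Y_le (hr.norm_lt j).le).trans_lt (hr.norm_lt j))
      simpa using mul_pos Q.mu_pos (by linarith : 0 < 1 - (Q.Y (r j)).re)
    have hG := hr.G_mul_lst j
    have hmu : (Q.mu : ℂ) ≠ 0 := by exact_mod_cast Q.mu_pos.ne'
    have hY := Q.one_sub_Y_ne_zero (hr.norm_lt j)
    rw [Q.integral_exp_ageMeasure hre]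
    generalize Q.G (r j)⁻¹ = γ at hG ⊢
    field_simp
    linear_combination c j * r j ^ m * hG
  refine ⟨p, fun m => ?_, hpos, ?_⟩
  · rw [← ageMeasure_univ]
    simp_rw [← Q.lintegral_ageMeasure (Q.measurable_afterArrival _ m)]
    rfl
  · have hsum := (Complex.hasSum_ofReal.2 p.hasSum_toReal)
    have h0 := hsum.summable.tsum_eq_zero_add
    rw [hsum.tsum_eq] at h0
    have h1 : ∀ m : ℕ, ((p (m + 1)).toReal : ℂ) =
        ∑ j, c j * ((Q.G (r j)⁻¹ - 1) / (Q.mu * (1 - Q.Y (r j)))) * r j * r j ^ m := by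
      intro m
      rw [← hpos (m + 1) (by omega), contArb]
      refine Finset.sum_congr rfl fun j _ => ?_
      ring
    simp_rw [h1] at h0
    rw [Summable.tsum_finsetSum fun j _ =>
      (summable_geometric_of_norm_lt_one (hr.norm_lt j)).mul_left _] at h0
    simp_rw [tsum_mul_left, tsum_geometric_of_norm_lt_one (hr.norm_lt _)] at h0
    rw [contArbZero]
    rw [Complex.ofReal_one] at h0
    refine (Eq.trans ?_ (sub_eq_of_eq_add h0))
    congr 1
    refine Finset.sum_congr rfl fun j _ => ?_
    have hsumG : ∑ i ∈ Finset.Icc 1 Q.b, ((Q.g i).toReal : ℂ) * r j ^ (1 - (i : ℤ)) =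
        r j * Q.G (r j)⁻¹ := by
      rw [G, Finset.mul_sum]
      refine Finset.sum_congr rfl fun i _ => ?_
      rw [zpow_sub₀ (hr0 j), zpow_one, zpow_natCast, inv_pow]
      ring
    have hmu : (Q.mu : ℂ) ≠ 0 := by exact_mod_cast Q.mu_pos.ne'
    have hY := Q.one_sub_Y_ne_zero (hr.norm_lt j)
    have h1r : 1 - r j ≠ 0 := sub_ne_zero.2 (hr.ne_one j).symm
    rw [hsumG]
    generalize Q.G (r j)⁻¹ = γ
    field_simp

end Roots

/-! ### Relabelling of roots and limits of the formulas -/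

theorem ListsZeros.exists_perm {b : ℕ} {f : ℂ → ℂ} {r r₀ : Fin b → ℂ} (h : ListsZeros f r)
    (h₀ : ListsZeros f r₀) : ∃ σ : Equiv.Perm (Fin b), ∀ j, r j = r₀ (σ j) := by
  have hex : ∀ j, ∃ k, r₀ k = r j := fun j => (h₀.2 _).2 ((h.2 _).1 ⟨j, rfl⟩)
  choose σ hσ using hex
  have hinj : Function.Injective σ := fun i j hij => h.1 (by rw [← hσ, ← hσ, hij])
  exact ⟨Equiv.ofBijective σ (Finite.injective_iff_bijective.1 hinj), fun j => (hσ j).symm⟩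

theorem systemSolution_comp_perm {b : ℕ} (r : Fin b → ℂ) (σ : Equiv.Perm (Fin b)) (j : Fin b) :
    systemSolution (fun i => r (σ i)) j = systemSolution r (σ j) := by
  simp only [systemSolution, lagrangeAtOne]
  congr 1
  exact Finset.prod_equiv σ (by simp) fun i _ => rfl

theorem tendsto_systemSolution {ι : Type*} {l : Filter ι} {b : ℕ} {r : ι → Fin b → ℂ}
    {r' : Fin b → ℂ} (hr : ∀ j, Tendsto (fun i => r i j) l (𝓝 (r' j)))
    (hinj : Function.Injective r') (j : Fin b) :
    Tendsto (fun i => systemSolution (r i) j) l (𝓝 (systemSolution r' j)) := by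
  refine (((hr j).pow _).mul ((hr j).const_sub 1)).mul (tendsto_finsetProd _ fun k hk => ?_)
  refine ((hr k).const_sub 1).div ((hr j).sub (hr k)) (sub_ne_zero.2 fun h => ?_)
  exact (Finset.mem_erase.1 hk).1 (hinj h).symm

theorem ListsZeros.solvesSystem_iff {b : ℕ} (hb : 0 < b) {f : ℂ → ℂ} {r : Fin b → ℂ}
    (h : ListsZeros f r) (hf : f 0 ≠ 0) (l : ℝ) (c : Fin b → ℂ) :
    SolvesSystem l r c ↔ c = fun j => l * systemSolution r j :=
  BatchQueue.solvesSystem_iff hb h.1 (h.ne_zero hf) h.ne_one l c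

section Limits

variable {r : ℝ → Fin Q.b → ℂ} {c : ℝ → Fin Q.b → ℂ} {r' c' : Fin Q.b → ℂ}

theorem tendsto_preFormula {l : ℝ → ℝ} (hl : Tendsto (fun Δ => l Δ / Δ) (𝓝[>] 0) (𝓝 Q.lam))
    (hr : ∀ j, Tendsto (fun Δ => r Δ j) (𝓝[>] 0) (𝓝 (r' j)))
    (hc : ∀ j, Tendsto (fun Δ : ℝ => c Δ j / (Δ : ℂ)) (𝓝[>] 0) (𝓝 (c' j))) (n : ℕ) :
    Tendsto (fun Δ : ℝ => preFormula (l Δ) (r Δ) (c Δ) n) (𝓝[>] 0)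
      (𝓝 (preFormula Q.lam r' c' n)) := by
  have hl' : Tendsto (fun Δ => ((l Δ / Δ : ℝ) : ℂ)) (𝓝[>] 0) (𝓝 (Q.lam : ℂ)) :=
    (Complex.continuous_ofReal.tendsto _).comp hl
  have hlam : (Q.lam : ℂ) ≠ 0 := by exact_mod_cast Q.lam_pos.ne'
  have h := ((tendsto_const_nhds (x := (1 : ℂ))).div hl' hlam).mul
    (tendsto_finsetSum Finset.univ fun j _ => (hc j).mul ((hr j).pow n))
  refine h.congr' ?_
  filter_upwards [self_mem_nhdsWithin] with Δ hΔ
  have hΔ0 : (Δ : ℂ) ≠ 0 := by exact_mod_cast (ne_of_gt hΔ)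
  rw [preFormula, Finset.mul_sum, Finset.mul_sum]
  refine Finset.sum_congr rfl fun j _ => ?_
  simp only [Pi.div_apply]
  push_cast
  rw [one_div_div]
  field_simp

theorem tendsto_Y_comp (hr : ∀ j, Tendsto (fun Δ => r Δ j) (𝓝[>] 0) (𝓝 (r' j)))
    (hlt : ∀ j, ‖r' j‖ < 1) (j : Fin Q.b) :
    Tendsto (fun Δ => Q.Y (r Δ j)) (𝓝[>] 0) (𝓝 (Q.Y (r' j))) :=
  (Q.differentiableOn_Y.differentiableAt
    (Metric.isOpen_ball.mem_nhds (by simpa using hlt j))).continuousAt.tendsto.comp (hr j)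

theorem tendsto_one_sub_add_mul_Y (hr : ∀ j, Tendsto (fun Δ => r Δ j) (𝓝[>] 0) (𝓝 (r' j)))
    (hlt : ∀ j, ‖r' j‖ < 1) (j : Fin Q.b) :
    Tendsto (fun Δ : ℝ => 1 - ((Q.mu * Δ : ℝ) : ℂ) + (Q.mu * Δ : ℝ) * Q.Y (r Δ j)) (𝓝[>] 0)
      (𝓝 1) := by
  have hm : Tendsto (fun Δ : ℝ => ((Q.mu * Δ : ℝ) : ℂ)) (𝓝[>] 0) (𝓝 0) := by
    have : Tendsto (fun Δ : ℝ => ((Q.mu * Δ : ℝ) : ℂ)) (𝓝 0) (𝓝 ((Q.mu * 0 : ℝ) : ℂ)) := by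
      apply Continuous.tendsto; fun_prop
    simpa using this.mono_left nhdsWithin_le_nhds
  simpa using (hm.const_sub 1).add (hm.mul (Q.tendsto_Y_comp hr hlt j))

/-- The factor 1/Δ from the denominator μΔ(1 - Y) is absorbed by c_j, leaving c_j/Δ, while 1 - μΔ +
μΔY tends to 1. -/
theorem tendsto_discArb (hr : ∀ j, Tendsto (fun Δ => r Δ j) (𝓝[>] 0) (𝓝 (r' j)))
    (hc : ∀ j, Tendsto (fun Δ : ℝ => c Δ j / (Δ : ℂ)) (𝓝[>] 0) (𝓝 (c' j)))
    (hlt : ∀ j, ‖r' j‖ < 1) (hne : ∀ j, r' j ≠ 0) (n : ℕ) :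
    Tendsto (fun Δ : ℝ => Q.discArb (Q.mu * Δ) (r Δ) (c Δ) n) (𝓝[>] 0)
      (𝓝 (Q.contArb r' c' n)) := by
  have hmu : (Q.mu : ℂ) ≠ 0 := by exact_mod_cast Q.mu_pos.ne'
  refine tendsto_finsetSum Finset.univ fun j _ => ?_
  have hY := Q.one_sub_Y_ne_zero (hlt j)
  have h := ((hc j).mul (((Q.tendsto_one_sub_add_mul_Y hr hlt j).mul
    (((Q.differentiable_gRev.continuous.tendsto _).comp (hr j)).sub ((hr j).pow Q.b))).div
      (((Q.tendsto_Y_comp hr hlt j).const_sub 1).const_mul (Q.mu : ℂ)) (mul_ne_zero hmu hY))).mul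
      ((hr j).zpow₀ ((n : ℤ) - Q.b) (Or.inl (hne j)))
  have hval : c' j * (1 * (Q.gRev (r' j) - r' j ^ Q.b) / (Q.mu * (1 - Q.Y (r' j)))) *
      r' j ^ ((n : ℤ) - Q.b) =
      c' j * ((Q.G (r' j)⁻¹ - 1) / (Q.mu * (1 - Q.Y (r' j)))) * r' j ^ n := by
    have := pow_ne_zero Q.b (hne j)
    rw [Q.gRev_eq (hne j), zpow_sub₀ (hne j), zpow_natCast, zpow_natCast]
    generalize Q.G (r' j)⁻¹ = γ
    field_simp
  rw [hval] at h
  refine h.congr' ?_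
  filter_upwards [self_mem_nhdsWithin] with Δ hΔ
  have hΔ0 : (Δ : ℂ) ≠ 0 := by exact_mod_cast (ne_of_gt hΔ)
  congr 1
  simp only [Function.comp]
  simp only [Pi.div_apply]
  push_cast
  rw [div_mul_div_comm, mul_div_assoc']
  congr 1
  ring

theorem tendsto_discArbZero (hr : ∀ j, Tendsto (fun Δ => r Δ j) (𝓝[>] 0) (𝓝 (r' j)))
    (hc : ∀ j, Tendsto (fun Δ : ℝ => c Δ j / (Δ : ℂ)) (𝓝[>] 0) (𝓝 (c' j)))
    (hlt : ∀ j, ‖r' j‖ < 1) (hne : ∀ j, r' j ≠ 0) :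
    Tendsto (fun Δ : ℝ => Q.discArbZero (Q.mu * Δ) (r Δ) (c Δ)) (𝓝[>] 0)
      (𝓝 (Q.contArbZero r' c')) := by
  have hmu : (Q.mu : ℂ) ≠ 0 := by exact_mod_cast Q.mu_pos.ne'
  refine (tendsto_finsetSum Finset.univ fun j _ => ?_).const_sub 1
  have hY := Q.one_sub_Y_ne_zero (hlt j)
  have h1 : 1 - r' j ≠ 0 := sub_ne_zero.2 fun h => by simpa [← h] using hlt j
  have hG : Tendsto (fun Δ => ∑ i ∈ Finset.Icc 1 Q.b,
      ((Q.g i).toReal : ℂ) * r Δ j ^ (1 - (i : ℤ)) - r Δ j) (𝓝[>] 0)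
      (𝓝 (∑ i ∈ Finset.Icc 1 Q.b, ((Q.g i).toReal : ℂ) * r' j ^ (1 - (i : ℤ)) - r' j)) :=
    (tendsto_finsetSum _ fun i _ => ((hr j).zpow₀ _ (Or.inl (hne j))).const_mul _).sub (hr j)
  have h := (hc j).mul (((Q.tendsto_one_sub_add_mul_Y hr hlt j).mul hG).div
      ((((hr j).const_sub 1).const_mul (Q.mu : ℂ)).mul ((Q.tendsto_Y_comp hr hlt j).const_sub 1))
      (mul_ne_zero (mul_ne_zero hmu h1) hY))
  rw [one_mul] at h
  refine h.congr' ?_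
  filter_upwards [self_mem_nhdsWithin] with Δ hΔ
  have hΔ0 : (Δ : ℂ) ≠ 0 := by exact_mod_cast (ne_of_gt hΔ)
  simp only [Pi.div_apply]
  push_cast
  rw [div_mul_div_comm, mul_div_assoc']
  congr 1
  ring

end Limits

theorem tendsto_systemSolution_div {l : ℝ → ℝ}
    (hl : Tendsto (fun Δ => l Δ / Δ) (𝓝[>] 0) (𝓝 Q.lam)) {b : ℕ} {r : ℝ → Fin b → ℂ}
    {r' : Fin b → ℂ} (hr : ∀ j, Tendsto (fun Δ => r Δ j) (𝓝[>] 0) (𝓝 (r' j)))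
    (hinj : Function.Injective r') (j : Fin b) :
    Tendsto (fun Δ : ℝ => (l Δ : ℂ) * systemSolution (r Δ) j / (Δ : ℂ)) (𝓝[>] 0)
      (𝓝 (Q.lam * systemSolution r' j)) := by
  have hl' : Tendsto (fun Δ => ((l Δ / Δ : ℝ) : ℂ)) (𝓝[>] 0) (𝓝 (Q.lam : ℂ)) :=
    (Complex.continuous_ofReal.tendsto _).comp hl
  refine (hl'.mul (tendsto_systemSolution hr hinj j)).congr fun Δ => ?_
  push_cast
  ring

theorem exists_listsZeros_discChar_tendsto (hrho : Q.rho < 1) {r' : Fin Q.b → ℂ}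
    (hr' : ListsZeros Q.contChar r') : ∃ r : ℝ → Fin Q.b → ℂ,
      (∀ᶠ Δ in 𝓝[>] (0 : ℝ), ListsZeros (Q.discChar Δ) (r Δ)) ∧
        ∀ j, Tendsto (fun Δ : ℝ => r Δ j) (𝓝[>] 0) (𝓝 (r' j)) := by
  have hev := Q.eventually_mul_lt_one
  exact exists_listsZeros_tendsto Q.tendstoLocallyUniformlyOn_discChar
    (hev.mono fun Δ h => Q.differentiableOn_discChar h.1 h.2) Q.differentiableOn_contChar
    Q.contChar_zero_ne_zero (hev.mono fun Δ h => Q.discChar_zero_ne_zero h.1 h.2)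
    (hev.mono fun Δ h => Q.hasExactlyZeros_discChar hrho h.1 h.2) hr'

end BatchQueue

/-! ### Assembly of the theorem -/

theorem mainTheorem3 (Q : BatchQueue) (hrho : Q.rho < 1) :
    -- the mean of the discretised inter-arrival time, in the original time unit
    Tendsto (fun Δ : ℝ => Q.slotMean Δ * Δ) (𝓝[>] 0) (𝓝 (1 / Q.lam)) ∧
    -- convergence of the transform and of the characteristic equation
    (∀ s : ℂ, ‖s‖ ≤ 1 →
      Tendsto (fun Δ : ℝ => Q.discTransform Δ s) (𝓝[>] 0) (𝓝 (Q.lst (Q.mu * (1 - Q.Y s)))) ∧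
      Tendsto (fun Δ : ℝ => Q.discChar Δ s) (𝓝[>] 0) (𝓝 (Q.contChar s))) ∧
    -- each characteristic equation has exactly `b` roots inside the unit circle
    (∀ Δ : ℝ, 0 < Δ → Q.mu * Δ < 1 → BatchQueue.HasExactlyZeros (Q.discChar Δ) Q.b) ∧
    BatchQueue.HasExactlyZeros Q.contChar Q.b ∧
    -- the case of distinct roots `r'` of the continuous-time characteristic equation
    ∀ r' : Fin Q.b → ℂ, BatchQueue.ListsZeros Q.contChar r' →
      -- convergence of the roots
      (∃ r : ℝ → Fin Q.b → ℂ,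
        (∀ᶠ Δ in 𝓝[>] (0 : ℝ), BatchQueue.ListsZeros (Q.discChar Δ) (r Δ)) ∧
        ∀ j, Tendsto (fun Δ : ℝ => r Δ j) (𝓝[>] 0) (𝓝 (r' j))) ∧
      ∃ c' : Fin Q.b → ℂ,
        -- the constants of the continuous-time queue
        BatchQueue.SolvesSystem Q.lam r' c' ∧
        (∀ c, BatchQueue.SolvesSystem Q.lam r' c → c = c') ∧
        -- with `r'` in place of the roots, the constants are linear in `Δ`
        (∀ (Δ : ℝ) (c : Fin Q.b → ℂ),
          BatchQueue.SolvesSystem (Q.lam * Δ) r' c ↔ c = fun j => c' j * Δ) ∧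
        (∀ n : ℕ, Tendsto (fun Δ : ℝ =>
            BatchQueue.preFormula (Q.lam * Δ) r' (fun j => c' j * Δ) n) (𝓝[>] 0)
          (𝓝 (BatchQueue.preFormula Q.lam r' c' n))) ∧
        (∀ n : ℕ, 1 ≤ n → Tendsto (fun Δ : ℝ =>
            Q.discArb (Q.mu * Δ) r' (fun j => c' j * Δ) n) (𝓝[>] 0) (𝓝 (Q.contArb r' c' n))) ∧
        Tendsto (fun Δ : ℝ => Q.discArbZero (Q.mu * Δ) r' (fun j => c' j * Δ)) (𝓝[>] 0)
          (𝓝 (Q.contArbZero r' c')) ∧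
        -- with the true roots and constants of the discretised queue
        (∀ (l : ℝ → ℝ) (r : ℝ → Fin Q.b → ℂ),
          Tendsto (fun Δ : ℝ => l Δ / Δ) (𝓝[>] 0) (𝓝 Q.lam) →
          (∀ᶠ Δ in 𝓝[>] (0 : ℝ), BatchQueue.ListsZeros (Q.discChar Δ) (r Δ)) →
          (∀ᶠ Δ in 𝓝[>] (0 : ℝ), ∃! c, BatchQueue.SolvesSystem (l Δ) (r Δ) c) ∧
          ∀ c : ℝ → Fin Q.b → ℂ,
            (∀ᶠ Δ in 𝓝[>] (0 : ℝ), BatchQueue.SolvesSystem (l Δ) (r Δ) (c Δ)) →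
            ((∀ j, Tendsto (fun Δ : ℝ => r Δ j) (𝓝[>] 0) (𝓝 (r' j))) →
              ∀ j, Tendsto (fun Δ : ℝ => c Δ j / (Δ : ℂ)) (𝓝[>] 0) (𝓝 (c' j))) ∧
            (∀ n : ℕ, Tendsto (fun Δ : ℝ => BatchQueue.preFormula (l Δ) (r Δ) (c Δ) n) (𝓝[>] 0)
              (𝓝 (BatchQueue.preFormula Q.lam r' c' n))) ∧
            (∀ n : ℕ, 1 ≤ n → Tendsto (fun Δ : ℝ => Q.discArb (Q.mu * Δ) (r Δ) (c Δ) n) (𝓝[>] 0)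
              (𝓝 (Q.contArb r' c' n))) ∧
            Tendsto (fun Δ : ℝ => Q.discArbZero (Q.mu * Δ) (r Δ) (c Δ)) (𝓝[>] 0)
              (𝓝 (Q.contArbZero r' c'))) ∧
        -- the limits are the distributions of the continuous-time queue
        ∃ π p : PMF ℕ, Q.IsPreArrivalDist π ∧ (∀ π', Q.IsPreArrivalDist π' → π' = π) ∧
          Q.IsArbitraryEpochDist π p ∧
          (∀ n : ℕ, BatchQueue.preFormula Q.lam r' c' n = ((π n).toReal : ℂ)) ∧
          (∀ n : ℕ, 1 ≤ n → Q.contArb r' c' n = ((p n).toReal : ℂ)) ∧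
          Q.contArbZero r' c' = ((p 0).toReal : ℂ) := by
  refine ⟨Q.tendsto_slotMean_mul, fun s hs => ⟨Q.tendsto_discTransform hs, Q.tendsto_discChar hs⟩,
    fun Δ h0 h1 => Q.hasExactlyZeros_discChar hrho h0 h1, Q.hasExactlyZeros_contChar hrho,
    fun r' hr' => ⟨Q.exists_listsZeros_discChar_tendsto hrho hr', ?_⟩⟩
  have hsys := hr'.solvesSystem_iff Q.b_pos Q.contChar_zero_ne_zero
  have hlt := hr'.norm_lt
  have hne := hr'.ne_zero Q.contChar_zero_ne_zero
  set c' : Fin Q.b → ℂ := fun j => Q.lam * BatchQueue.systemSolution r' j with hc'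
  have hsol : BatchQueue.SolvesSystem Q.lam r' c' := (hsys _ _).2 rfl
  have hr'const : ∀ j, Tendsto (fun _ : ℝ => r' j) (𝓝[>] 0) (𝓝 (r' j)) := fun j =>
    tendsto_const_nhds
  have hc'const : ∀ j, Tendsto (fun Δ : ℝ => c' j * Δ / (Δ : ℂ)) (𝓝[>] 0) (𝓝 (c' j)) := fun j => by
    refine tendsto_const_nhds.congr' ?_
    filter_upwards [self_mem_nhdsWithin] with Δ hΔ
    have hΔ0 : (Δ : ℂ) ≠ 0 := by exact_mod_cast (ne_of_gt hΔ)
    field_simp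
  have hlconst : Tendsto (fun Δ : ℝ => Q.lam * Δ / Δ) (𝓝[>] 0) (𝓝 Q.lam) := by
    refine tendsto_const_nhds.congr' ?_
    filter_upwards [self_mem_nhdsWithin] with Δ hΔ
    have hΔ0 : Δ ≠ 0 := ne_of_gt hΔ
    field_simp
  refine ⟨c', hsol, fun c hc => (hsys _ _).1 hc, fun Δ c => ?_,
    Q.tendsto_preFormula hlconst hr'const hc'const,
    fun n _ => Q.tendsto_discArb hr'const hc'const hlt hne n,
    Q.tendsto_discArbZero hr'const hc'const hlt hne, fun l r hl hr => ?_, ?_⟩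
  · rw [hsys]
    have : (fun j => ((Q.lam * Δ : ℝ) : ℂ) * BatchQueue.systemSolution r' j) =
        fun j => c' j * Δ := by
      funext j
      rw [hc']
      push_cast
      ring
    rw [this]
  · have hdsys : ∀ᶠ Δ in 𝓝[>] (0 : ℝ), ∀ c, BatchQueue.SolvesSystem (l Δ) (r Δ) c ↔
        c = fun j => l Δ * BatchQueue.systemSolution (r Δ) j := by
      filter_upwards [hr, Q.eventually_mul_lt_one] with Δ h1 h2
      exact h1.solvesSystem_iff Q.b_pos (Q.discChar_zero_ne_zero h2.1 h2.2) _
    refine ⟨hdsys.mono fun Δ h => ⟨_, (h _).2 rfl, fun c hc => (h c).1 hc⟩, fun c hc => ?_⟩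
    have hceq : ∀ᶠ Δ in 𝓝[>] (0 : ℝ),
        c Δ = fun j => l Δ * BatchQueue.systemSolution (r Δ) j := by
      filter_upwards [hdsys, hc] with Δ h1 h2 using (h1 _).1 h2
    -- The given labelling may jump with Δ, so its roots need not converge. It is compared with a
    -- convergent labelling `r₀` through a permutation depending on Δ; the formulas, being symmetric
    -- sums over the roots, do not notice.
    obtain ⟨r₀, hr₀, hr₀lim⟩ := Q.exists_listsZeros_discChar_tendsto hrho hr'
    have hc₀lim := Q.tendsto_systemSolution_div hl hr₀lim hr'.1
    have hperm : ∀ᶠ Δ in 𝓝[>] (0 : ℝ), ∃ σ : Equiv.Perm (Fin Q.b), (∀ j, r Δ j = r₀ Δ (σ j)) ∧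
        ∀ j, c Δ j = l Δ * BatchQueue.systemSolution (r₀ Δ) (σ j) := by
      filter_upwards [hr, hr₀, hceq] with Δ h1 h2 h3
      obtain ⟨σ, hσ⟩ := h1.exists_perm h2
      refine ⟨σ, hσ, fun j => ?_⟩
      rw [h3, ← BatchQueue.systemSolution_comp_perm, ← funext hσ]
    refine ⟨fun hlim j => ?_, fun n => ?_, fun n _ => ?_, ?_⟩
    · refine (Q.tendsto_systemSolution_div hl hlim hr'.1 j).congr' ?_
      filter_upwards [hceq] with Δ h
      rw [h]
    · refine (Q.tendsto_preFormula hl hr₀lim hc₀lim n).congr' ?_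
      filter_upwards [hperm] with Δ ⟨σ, h1, h2⟩
      simp only [BatchQueue.preFormula, h1, h2]
      rw [Equiv.sum_comp σ fun j => l Δ * BatchQueue.systemSolution (r₀ Δ) j * r₀ Δ j ^ n]
    · refine (Q.tendsto_discArb hr₀lim hc₀lim hlt hne n).congr' ?_
      filter_upwards [hperm] with Δ ⟨σ, h1, h2⟩
      simp only [BatchQueue.discArb, h1, h2]
      exact (Equiv.sum_comp σ _).symm
    · refine (Q.tendsto_discArbZero hr₀lim hc₀lim hlt hne).congr' ?_
      filter_upwards [hperm] with Δ ⟨σ, h1, h2⟩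
      simp only [BatchQueue.discArbZero, h1, h2]
      congr 1
      exact (Equiv.sum_comp σ _).symm
  · obtain ⟨π, hπ, hval⟩ := BatchQueue.exists_isPreArrivalDist hr' hsol
    obtain ⟨p, hp, hpn, hp0⟩ := BatchQueue.exists_isArbitraryEpochDist hr' hsol hval
    exact ⟨π, p, hπ, fun π' h => hπ.unique Q h, hp, hval, hpn, hp0⟩
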